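/- Let $D$ be a link diagram on the sphere $S^2$ (possibly with disconnected projection, and possibly with components without crossings) with $n$ crossings. Suppose that $D$ is $k$-almost alternating, that is, there are $k$ crossings of $D$ such that switching all of them turns $D$ into an alternating diagram, and no set of fewer than $k$ crossings has this property. Fix such a set of $k$ crossings, called the dealternators. Let $|s_AD|$ and $|s_BD|$ be the numbers of circles obtained from $D$ by applying the $A$-smoothing, respectively the $B$-smoothing, to all crossings of $D$. Let $S$ be the surface obtained from $S^2$ as follows. Around each dealternator take a small closed disc $O$ whose boundary cuts $D$ transversally in four points $a,b,c,d$ (in counterclockwise order). Delete the interior of $O$ and glue in two bands, i.e. copies of $[0,1]\times[0,1]$: the sides $\{0\}\times[0,1]$ and $\{1\}\times[0,1]$ of the first band are identified with the arcs $ab$ and $dc$ of $\partial O$, and those of the second band with the arcs $bc$ and $ad$, respectively (an arc $pq$ being traversed from $p$ to $q$). Let $\Gamma_D\subset S$ be the graph consisting of the part of the projection of $D$ outside the deleted discs, together with the edges $[0,1]\times\{0\}$ and $[0,1]\times\{1\}$ of all the bands. Let $r$ be the number of connected components of $S\setminus\Gamma_D$. Then $$|s_AD|+|s_BD| = 2k+2r-n-2.$$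 -/

import Mathlib

open scoped unitInterval

/-! ### Finite cell decompositions of the 2-sphere -/

/-- A finite cell decomposition of the oriented sphere `S²`, as a combinatorial map with set of
half-edges (darts) `H`. A dart is an edge together with one of its two ends.
`rot` sends a dart to the next dart, counterclockwise, around the same vertex; `flip` exchanges the two
darts of an edge. Cells: vertices are the cycles of `rot`, edges the cycles of `flip`, and faces the
cycles of `rot⁻¹ * flip` (the walk that keeps the face on its left). The surface is the sphere: it is
connected and its Euler characteristic is `2`. -/
structure SphereMap (H : Type*) [Fintype H] [DecidableEq H] where
  rot : Equiv.Perm H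
  flip : Equiv.Perm H
  flip_flip : ∀ d, flip (flip d) = d
  flip_ne : ∀ d, flip d ≠ d
  nonempty : Nonempty H
  connected : ∀ d e, ∃ g ∈ Subgroup.closure {rot, flip}, g d = e
  euler : (Nat.card (Quotient (Equiv.Perm.SameCycle.setoid rot)) : ℤ)
      - Nat.card (Quotient (Equiv.Perm.SameCycle.setoid flip))
      + Nat.card (Quotient (Equiv.Perm.SameCycle.setoid (rot⁻¹ * flip))) = 2

namespace SphereMap

variable {H : Type*} [Fintype H] [DecidableEq H] (M : SphereMap H)

/-- The vertices of the decomposition. -/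
def Vertex : Type _ := Quotient (Equiv.Perm.SameCycle.setoid M.rot)

/-- The vertex at which a dart is based. -/
def vertex (d : H) : M.Vertex := Quotient.mk (Equiv.Perm.SameCycle.setoid M.rot) d

/-- A chosen dart at a given vertex. -/
noncomputable def someDart (v : M.Vertex) : H := Quotient.out v

/-- Gluing of the sphere from unit squares, one for each dart `d`: the square of `d` is the sector
at the vertex of `d` between `d` and the next dart `rot d`. In it `(0,0)` is the vertex, `(t,0)` runs
along `d` to the midpoint `(1,0)` of its edge, `(0,t)` runs along `rot d` to the midpoint `(0,1)` of
its edge, and `(1,1)` is the centre of the face. -/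
inductive Glue : (Σ _ : H, I × I) → (Σ _ : H, I × I) → Prop
  | halfEdge (d : H) (t : I) : Glue ⟨d, (0, t)⟩ ⟨M.rot d, (t, 0)⟩
  | midline (d : H) (t : I) : Glue ⟨d, (1, t)⟩ ⟨M.rot⁻¹ (M.flip d), (t, 1)⟩

/-- The sphere `S²` as a topological space (with the quotient topology). -/
def Sphere : Type _ := Quot M.Glue

instance : TopologicalSpace M.Sphere := inferInstanceAs (TopologicalSpace (Quot M.Glue))

/-- The point with coordinates `(x, y)` in the square of the dart `d`. -/
def pt (d : H) (x y : I) : M.Sphere := Quot.mk _ ⟨d, (x, y)⟩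

/-- The sum of the two coordinates; it is compatible with the gluing. -/
def height : M.Sphere → ℝ :=
  Quot.lift (fun p => (p.2.1 : ℝ) + (p.2.2 : ℝ)) (by
    rintro _ _ (⟨d, t⟩ | ⟨d, t⟩) <;> simp [add_comm])

/-- The interior of a small closed disc `O` around the vertex `v`. -/
def openDisc (v : M.Vertex) : Set M.Sphere :=
  {p | ∃ (d : H) (x y : I), M.vertex d = v ∧ (x : ℝ) + y < 1 / 2 ∧ p = M.pt d x y}

/-- The sphere with the interiors of the small discs around the vertices in `X` deleted. -/
def CutSphere (X : Set M.Vertex) : Type _ := {p : M.Sphere // ∀ v ∈ X, p ∉ M.openDisc v}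

instance (X : Set M.Vertex) : TopologicalSpace (M.CutSphere X) :=
  inferInstanceAs (TopologicalSpace {p : M.Sphere // ∀ v ∈ X, p ∉ M.openDisc v})

/-- The arc of the circle `∂O` in the sector of the dart `d`: it runs counterclockwise from the
point `(1/2, 0)` of `d` (at `t = 0`) to the corresponding point of `rot d` (at `t = 1`). -/
noncomputable def arcPt (d : H) (t : I) : M.Sphere :=
  M.pt d ⟨(1 - t) / 2, by have := t.2.1; have := t.2.2; constructor <;> linarith⟩
    ⟨t / 2, by have := t.2.1; have := t.2.2; constructor <;> linarith⟩

theorem arcPt_notMem (d : H) (t : I) (v : M.Vertex) : M.arcPt d t ∉ M.openDisc v := by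
  rintro ⟨e, x, y, -, hxy, h⟩
  have h2 := congrArg M.height h
  simp only [height, arcPt, pt] at h2
  linarith

/-- The same arc, in the sphere with the open discs deleted. -/
noncomputable def cutArc (X : Set M.Vertex) (d : H) (t : I) : M.CutSphere X :=
  ⟨M.arcPt d t, fun v _ => M.arcPt_notMem d t v⟩

/-- Gluing of the two bands `[0,1] × [0,1]` at each vertex in `X` (only used at 4-valent vertices).
If `a, b = rot a, c = rot² a, d = rot³ a` are the points in which `∂O` cuts the four edges, then the band
with index `0` has `{0} × [0,1]` glued to the arc `ab` and `{1} × [0,1]` to `dc`, and the band with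
index `1` has `{0} × [0,1]` glued to `bc` and `{1} × [0,1]` to `ad`. -/
inductive BandGlue (X : Set M.Vertex) :
    M.CutSphere X ⊕ (Σ _ : X × Fin 2, I × I) → M.CutSphere X ⊕ (Σ _ : X × Fin 2, I × I) → Prop
  | left (v : X) (i : Fin 2) (t : I) :
      BandGlue X (Sum.inr ⟨(v, i), (0, t)⟩)
        (Sum.inl (M.cutArc X ((M.rot ^ (i : ℕ)) (M.someDart v)) t))
  | right (v : X) (i : Fin 2) (t : I) :
      BandGlue X (Sum.inr ⟨(v, i), (1, t)⟩)
        (Sum.inl (M.cutArc X ((M.rot ^ ((i : ℕ) + 2)) (M.someDart v)) (unitInterval.symm t)))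

/-- The surface obtained from the sphere by the surgery at the vertices in `X`. -/
def Surgery (X : Set M.Vertex) : Type _ := Quot (M.BandGlue X)

instance (X : Set M.Vertex) : TopologicalSpace (M.Surgery X) :=
  inferInstanceAs (TopologicalSpace (Quot (M.BandGlue X)))

end SphereMap

/-! ### Link diagrams -/

/-- A link diagram on the sphere, drawn in the 1-skeleton of a cell decomposition `M`.
The projection is the union of the edges whose darts lie in `strand` (the other edges of `M` are
auxiliary, so disconnected projections and closed curves without crossings are allowed).
It passes through each vertex `0`, `1` or `2` times, i.e. has `0`, `2` or `4` darts there; the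
vertices of the last kind are the crossings, and no auxiliary edge ends at a crossing.
`isOver d` says that the dart `d` at a crossing belongs to the overpassing strand (it has no meaning
at other vertices): of the four darts at a crossing, two opposite ones are over and the other two
are under. -/
structure LinkDiagram {H : Type*} [Fintype H] [DecidableEq H] (M : SphereMap H) where
  strand : Set H
  strand_flip : ∀ d ∈ strand, M.flip d ∈ strand
  valence : ∀ v : M.Vertex, {d | d ∈ strand ∧ M.vertex d = v}.ncard ∈ ({0, 2, 4} : Set ℕ)
  full : ∀ d, {e | e ∈ strand ∧ M.vertex e = M.vertex d}.ncard = 4 → d ∈ strand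
  isOver : H → Prop
  isOver_rot : ∀ d, {e | e ∈ strand ∧ M.vertex e = M.vertex d}.ncard = 4 →
    (isOver (M.rot d) ↔ ¬ isOver d)

namespace LinkDiagram

variable {H : Type*} [Fintype H] [DecidableEq H] {M : SphereMap H} (D : LinkDiagram M)

/-- The vertex `v` is a crossing of the diagram. -/
def IsCrossing (v : M.Vertex) : Prop := {d | d ∈ D.strand ∧ M.vertex d = v}.ncard = 4

/-- The number `n` of crossings. -/
noncomputable def crossingNumber : ℕ := {v | D.IsCrossing v}.ncard

/-- Two darts of the projection are the two ends of an edge, or lie at the same vertex that is not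
a crossing (so the projection runs from the one to the other). -/
def ArcStep (d e : D.strand) : Prop :=
  e.1 = M.flip d.1 ∨ (M.vertex d.1 = M.vertex e.1 ∧ ¬ D.IsCrossing (M.vertex d.1))

/-- The diagram is alternating: along the link, over- and underpasses alternate. That is, each arc
of the projection that runs from a crossing to the next one is over at one of its two ends and
under at the other one. -/
def IsAlternating : Prop :=
  ∀ d e : D.strand, d ≠ e → D.IsCrossing (M.vertex d.1) → D.IsCrossing (M.vertex e.1) →
    Relation.EqvGen D.ArcStep d e → (D.isOver d.1 ↔ ¬ D.isOver e.1)

theorem vertex_rot (M : SphereMap H) (d : H) : M.vertex (M.rot d) = M.vertex d :=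
  Quotient.sound (s := Equiv.Perm.SameCycle.setoid M.rot) (Equiv.Perm.sameCycle_apply_left.2
    (Equiv.Perm.SameCycle.refl M.rot d))

/-- Switch the crossings in `X`: exchange over and under there. -/
def switch (X : Set M.Vertex) : LinkDiagram M where
  strand := D.strand
  strand_flip := D.strand_flip
  valence := D.valence
  full := D.full
  isOver d := Xor (M.vertex d ∈ X) (D.isOver d)
  isOver_rot d hd := by
    have h := D.isOver_rot d hd
    rw [vertex_rot]
    simp only [Xor]
    tauto

/-- `X` is a set of `k` crossings such that switching all of them makes the diagram alternating. -/
def AlternatingAfter (X : Set M.Vertex) (k : ℕ) : Prop :=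
  (∀ v ∈ X, D.IsCrossing v) ∧ X.ncard = k ∧ (D.switch X).IsAlternating

/-- The diagram is `k`-almost alternating: some `k` crossings, and not less than `k`, can be
switched so that the diagram becomes alternating. -/
def IsAlmostAlternating (k : ℕ) : Prop :=
  (∃ X, D.AlternatingAfter X k) ∧ ∀ X j, D.AlternatingAfter X j → k ≤ j

/-- Smoothing of all crossings. At a crossing the four darts are reconnected in two pairs by short
arcs: an arc joins `d` to the next dart `rot d` whenever `turn d` holds. -/
def SmoothStep (turn : H → Prop) (d e : D.strand) : Prop :=
  D.ArcStep d e ∨ (D.IsCrossing (M.vertex d.1) ∧ turn d.1 ∧ e.1 = M.rot d.1)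

/-- `|s_A D|`. The `A`-regions at a crossing are the two sectors swept out when the overpassing
strand is turned counterclockwise, i.e. those between an over dart `d` and `rot d`. The
`A`-smoothing joins them, so its arcs cross the other two sectors, between an under dart `d` and
`rot d`. A circle is counted as the set of the darts that it contains. -/
noncomputable def circlesA : ℕ := Nat.card (Quot (D.SmoothStep fun d => ¬ D.isOver d))

/-- `|s_B D|`. The `B`-smoothing is the other one: its arcs join each over dart `d` to `rot d`. -/
noncomputable def circlesB : ℕ := Nat.card (Quot (D.SmoothStep fun d => D.isOver d))

/-- The projection of the diagram as a subset of the sphere. -/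
def projection : Set M.Sphere := {p | ∃ d ∈ D.strand, ∃ x : I, p = M.pt d x 0}

/-- The graph `Γ_D` in the surface obtained by surgery at the vertices in `X`: what is left of the
projection, together with the edges `[0,1] × {0}` and `[0,1] × {1}` of all bands. -/
def graph (X : Set M.Vertex) : Set (M.Surgery X) :=
  {q | (∃ p : M.CutSphere X, p.1 ∈ D.projection ∧ q = Quot.mk _ (Sum.inl p)) ∨
    ∃ (b : X × Fin 2) (s t : I), (t = 0 ∨ t = 1) ∧ q = Quot.mk _ (Sum.inr ⟨b, (s, t)⟩)}

/-- The number `r` of connected components of `S ∖ Γ_D`. -/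
noncomputable def regions (X : Set M.Vertex) : ℕ :=
  Nat.card (ConnectedComponents ↥(D.graph X)ᶜ)

end LinkDiagram

/-! Let `X` be the set of dealternators, `Y` the set of the other crossings, `s` the total number of
state circles, and `R(X)`, `R(Y)` the numbers of regions after surgery at `X` and at `Y`. The
formula is squeezed out of inequalities that hold for `X` and `Y` alike, since switching `Y` instead
of `X` gives the alternating diagram with over and under exchanged.

Cutting the sphere into sectors at the vertices turns regions into classes of sectors
(`regions_eq`). Alternation after switching provides a two-colouring of the sectors
(`exists_isShading`). The colour of a sector tells which smoothing has its circles running along the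
boundary of the region there, bands included. So each state circle has a region for `X` on one side
and a region for `Y` on the other.

Euler characteristic: the regions for `X` are assembled from faces, joined across auxiliary edges
and by bands. Capped off along the state circles, each has Euler characteristic at most `2`, whence
`n + 2 + s ≤ 2 R(X) + 2 |X|` (`le_two_mul_card_region`), and likewise for `Y`. The genus bound
behind this is linear algebra on permutations (`card_cycles_le`).

Connectedness: take all regions for `X` and for `Y` as vertices and the state circles as edges. This
graph has at most two components, so `R(X) + R(Y) ≤ s + 2` (`card_region_add_card_region_le`).

Since `|X| + |Y| = n`, adding the two Euler estimates gives `R(X) + R(Y) ≥ s + 2`. Hence all the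
inequalities are equalities, and the one for `X` is the formula. -/

/-! ### Cycles of permutations -/

namespace Equiv.Perm

variable {N : Type*}

/-- The operator `f ↦ f ∘ g - f` on functions. -/
noncomputable def shiftSub (g : Equiv.Perm N) : (N → ℚ) →ₗ[ℚ] (N → ℚ) :=
  LinearMap.funLeft ℚ ℚ g - LinearMap.id

theorem shiftSub_apply (g : Equiv.Perm N) (f : N → ℚ) (x : N) :
    shiftSub g f x = f (g x) - f x := rfl

/-- Pulling functions back along `a` embeds `A → ℚ` into the invariant functions. Cycles thus never
have to be identified: an invariant surjection already bounds their number from below. -/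
theorem card_le_finrank_ker_shiftSub [Fintype N] (g : Equiv.Perm N) {A : Type*} [Finite A] (a : N → A)
    (ha : Function.Surjective a) (h : ∀ x, a (g x) = a x) :
    Nat.card A ≤ Module.finrank ℚ (LinearMap.ker (shiftSub g)) := by
  have := Fintype.ofFinite A
  rw [Nat.card_eq_fintype_card, ← Module.finrank_pi (R := ℚ) (ι := A)]
  refine LinearMap.finrank_le_finrank_of_injective
    (f := (LinearMap.funLeft ℚ ℚ a).codRestrict _ fun f => ?_) ?_
  · ext x
    simp [shiftSub_apply, LinearMap.funLeft_apply, h]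
  · intro f f' hf
    exact LinearMap.funLeft_injective_of_surjective ℚ ℚ a ha (congrArg Subtype.val hf)

/-- The relation whose classes are the orbits of two permutations. -/
def OrbitStep (α β : Equiv.Perm N) (x y : N) : Prop := y = α x ∨ y = β x

theorem finrank_ker_inf_le [Fintype N] (α β : Equiv.Perm N) :
    Module.finrank ℚ (LinearMap.ker (shiftSub α) ⊓ LinearMap.ker (shiftSub β) :
      Submodule ℚ (N → ℚ)) ≤ Nat.card (Quot (OrbitStep α β)) := by
  have := Fintype.ofFinite (Quot (OrbitStep α β))
  rw [Nat.card_eq_fintype_card, ← Module.finrank_pi (R := ℚ) (ι := Quot (OrbitStep α β))]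
  refine LinearMap.finrank_le_finrank_of_injective
    (f := (LinearMap.funLeft ℚ ℚ Quot.out).comp (Submodule.subtype _)) ?_
  rintro ⟨f, hfα, hfβ⟩ ⟨f', hfα', hfβ'⟩ hff
  have key : ∀ f : N → ℚ, shiftSub α f = 0 → shiftSub β f = 0 → ∀ x y,
      Quot.mk (OrbitStep α β) x = Quot.mk _ y → f x = f y := by
    intro f h1 h2 x y hxy
    refine congrArg (Quot.lift f ?_) hxy
    rintro x _ (rfl | rfl)
    · have := congrFun h1 x
      rw [shiftSub_apply, Pi.zero_apply] at this
      linarith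
    · have := congrFun h2 x
      rw [shiftSub_apply, Pi.zero_apply] at this
      linarith
  ext x
  have h := congrFun hff (Quot.mk _ x)
  simp only [LinearMap.comp_apply, LinearMap.funLeft_apply, Submodule.subtype_apply] at h
  change f x = f' x
  rw [← key f hfα hfβ _ x (Quot.out_eq _), ← key f' hfα' hfβ' _ x (Quot.out_eq _)]
  exact h

/-- Modulo the two ranges, the indicator functions of points in one orbit coincide, so one class per
orbit spans the quotient. -/
theorem finrank_quotient_range_sup_le [Fintype N] (α β : Equiv.Perm N) :
    Module.finrank ℚ ((N → ℚ) ⧸ (LinearMap.range (shiftSub α) ⊔ LinearMap.range (shiftSub β)))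
      ≤ Nat.card (Quot (OrbitStep α β)) := by
  classical
  have := Fintype.ofFinite (Quot (OrbitStep α β))
  set W := LinearMap.range (shiftSub α) ⊔ LinearMap.range (shiftSub β)
  have hs : ∀ (g : Equiv.Perm N) (x : N),
      (Pi.single x 1 : N → ℚ) - Pi.single (g x) 1 = shiftSub g (Pi.single (g x) 1) := by
    intro g x
    ext y
    rw [shiftSub_apply]
    simp [Pi.single_apply]
  let b : Quot (OrbitStep α β) → (N → ℚ) ⧸ W := Quot.lift (fun x => W.mkQ (Pi.single x 1)) (by
    rintro x _ (rfl | rfl)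
    · refine (Submodule.Quotient.eq W).2 ?_
      rw [hs]
      exact Submodule.mem_sup_left ⟨_, rfl⟩
    · refine (Submodule.Quotient.eq W).2 ?_
      rw [hs]
      exact Submodule.mem_sup_right ⟨_, rfl⟩)
  have hb : Submodule.span ℚ (Set.range b) = ⊤ := by
    rw [eq_top_iff]
    rintro q -
    obtain ⟨f, rfl⟩ := W.mkQ_surjective q
    have hf : f = ∑ x, f x • (Pi.single x 1 : N → ℚ) := by
      ext y
      simp [Finset.sum_apply, Pi.single_apply]
    rw [hf, map_sum]
    refine Submodule.sum_mem _ fun x _ => ?_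
    rw [map_smul]
    exact Submodule.smul_mem _ _ (Submodule.subset_span ⟨Quot.mk _ x, rfl⟩)
  have h := finrank_range_le_card (R := ℚ) b
  rw [Set.finrank, hb, finrank_top] at h
  rwa [Nat.card_eq_fintype_card]

/-- The genus of a pair of permutations is nonnegative. -/
theorem card_cycles_le [Fintype N] (α β : Equiv.Perm N) {A B C : Type*} [Finite A] [Finite B] [Finite C]
    (a : N → A) (ha : Function.Surjective a) (haα : ∀ x, a (α x) = a x)
    (b : N → B) (hb : Function.Surjective b) (hbβ : ∀ x, b (β x) = b x)
    (c : N → C) (hc : Function.Surjective c) (hcαβ : ∀ x, c (α (β x)) = c x) :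
    Nat.card A + Nat.card B + Nat.card C
      ≤ Fintype.card N + 2 * Nat.card (Quot (OrbitStep α β)) := by
  have h1 := card_le_finrank_ker_shiftSub α a ha haα
  have h2 := card_le_finrank_ker_shiftSub β b hb hbβ
  have h3 := card_le_finrank_ker_shiftSub (α * β) c hc hcαβ
  have h4 := finrank_ker_inf_le α β
  have h5 := finrank_quotient_range_sup_le α β
  have h6 := LinearMap.finrank_range_add_finrank_ker (shiftSub α)
  have h7 := LinearMap.finrank_range_add_finrank_ker (shiftSub β)
  have h8 := Submodule.finrank_quotient_add_finrank
    (LinearMap.range (shiftSub α) ⊔ LinearMap.range (shiftSub β))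
  have h9 := Submodule.finrank_sup_add_finrank_inf_eq
    (LinearMap.range (shiftSub α)) (LinearMap.range (shiftSub β))
  -- Rank-nullity for `shiftSub α` on the functions invariant under `α * β`: its image lies in both
  -- ranges (`h11`) and its kernel in both kernels (`h12`). The dimension formula for the sum of the
  -- ranges then gives the bound.
  have h10 := LinearMap.finrank_range_add_finrank_ker
    ((shiftSub α).domRestrict (LinearMap.ker (shiftSub (α * β))))
  have hfun : ∀ f, shiftSub (α * β) f = shiftSub β (LinearMap.funLeft ℚ ℚ α f) + shiftSub α f := by
    intro f
    ext x
    simp only [shiftSub_apply, Pi.add_apply, LinearMap.funLeft_apply, Equiv.Perm.mul_apply]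
    ring
  have h11 : Module.finrank ℚ (LinearMap.range
      ((shiftSub α).domRestrict (LinearMap.ker (shiftSub (α * β)))))
      ≤ Module.finrank ℚ (LinearMap.range (shiftSub α) ⊓ LinearMap.range (shiftSub β) :
        Submodule ℚ (N → ℚ)) := by
    refine Submodule.finrank_mono ?_
    rintro _ ⟨⟨f, hf⟩, rfl⟩
    refine ⟨⟨f, rfl⟩, ⟨-LinearMap.funLeft ℚ ℚ α f, ?_⟩⟩
    have h := hfun f
    rw [LinearMap.mem_ker.1 hf] at h
    rw [map_neg, LinearMap.domRestrict_apply]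
    exact neg_eq_of_add_eq_zero_right h.symm
  have h12 : Module.finrank ℚ (LinearMap.ker
      ((shiftSub α).domRestrict (LinearMap.ker (shiftSub (α * β)))))
      ≤ Module.finrank ℚ (LinearMap.ker (shiftSub α) ⊓ LinearMap.ker (shiftSub β) :
        Submodule ℚ (N → ℚ)) := by
    refine LinearMap.finrank_le_finrank_of_injective
      (f := ((Submodule.subtype _).comp (Submodule.subtype _)).codRestrict _ ?_) ?_
    · rintro ⟨⟨f, hf⟩, hf'⟩
      have hf1 : shiftSub α f = 0 := hf'
      refine ⟨hf1, ?_⟩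
      have hα : LinearMap.funLeft ℚ ℚ α f = f := by
        have : LinearMap.funLeft ℚ ℚ α f - f = 0 := hf1
        exact sub_eq_zero.1 this
      have h := hfun f
      rw [LinearMap.mem_ker.1 hf, hf1, hα, add_zero] at h
      exact h.symm
    · intro x y hxy
      have h := congrArg Subtype.val hxy
      exact Subtype.ext (Subtype.ext h)
  have h13 : Module.finrank ℚ (N → ℚ) = Fintype.card N := Module.finrank_pi ℚ
  rw [h13] at h6 h7 h8
  omega

/-- An involution has at least `(card N + #fixed points) / 2` cycles. -/
theorem card_add_card_fixed_le [Fintype N] (τ : Equiv.Perm N) (hτ : ∀ x, τ (τ x) = x) :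
    Fintype.card N + Nat.card {x // τ x = x}
      ≤ 2 * Nat.card (Quotient (Equiv.Perm.SameCycle.setoid τ)) := by
  classical
  have := Fintype.ofFinite (Quotient (Equiv.Perm.SameCycle.setoid τ))
  have key : ∀ x y, (SameCycle.setoid τ) x y → y = x ∨ y = τ x := by
    rintro x _ ⟨i, rfl⟩
    have h2 : τ ^ (2 : ℤ) = 1 := by
      ext z
      simp [zpow_ofNat, pow_two, hτ]
    obtain ⟨j, rfl | rfl⟩ := Int.even_or_odd' i
    · left
      rw [zpow_mul, h2]
      simp
    · right
      rw [zpow_add, zpow_mul, h2]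
      simp
  have hfix : Nat.card {x // τ x = x} = (Finset.univ.filter fun x => τ x = x).card := by
    rw [Nat.card_eq_fintype_card, Fintype.card_subtype]
  rw [hfix, Nat.card_eq_fintype_card, ← Finset.card_univ, ← Finset.card_univ,
    Finset.card_eq_sum_card_fiberwise (s := Finset.univ) (t := Finset.univ)
      (f := fun x => (Quotient.mk (SameCycle.setoid τ) x)) (fun _ _ => Finset.mem_coe.2 (Finset.mem_univ _)),
    Finset.card_eq_sum_card_fiberwise (s := Finset.univ.filter fun x => τ x = x) (t := Finset.univ)
      (f := fun x => (Quotient.mk (SameCycle.setoid τ) x)) (fun _ _ => Finset.mem_coe.2 (Finset.mem_univ _)),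
    ← Finset.sum_add_distrib, mul_comm, ← smul_eq_mul]
  -- Each cycle contributes at most `2`: a fixed point counts once as a point and once as fixed, a
  -- 2-cycle has two points and none fixed.
  refine Finset.sum_le_card_nsmul _ _ _ fun q _ => ?_
  induction q using Quotient.inductionOn with | _ x
  have hsub : ∀ y, Quotient.mk (SameCycle.setoid τ) y = Quotient.mk _ x → y = x ∨ y = τ x :=
    fun y h => key x y (Quotient.exact h.symm)
  by_cases hx : τ x = x
  · have h1 : (Finset.univ.filter fun y => Quotient.mk (SameCycle.setoid τ) y = Quotient.mk _ x)
        ⊆ {x} := by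
      intro y hy
      rcases hsub y (Finset.mem_filter.1 hy).2 with h | h
      · simp [h]
      · simp [h, hx]
    have h2 := Finset.card_le_card h1
    have h3 := Finset.card_le_card ((Finset.filter_subset_filter _ (Finset.filter_subset
      (fun x => τ x = x) Finset.univ)).trans h1)
    rw [Finset.card_singleton] at h2 h3
    exact add_le_add h2 h3
  · have h1 : (Finset.univ.filter fun y => Quotient.mk (SameCycle.setoid τ) y = Quotient.mk _ x)
        ⊆ {x, τ x} := by
      intro y hy
      rcases hsub y (Finset.mem_filter.1 hy).2 with h | h <;> simp [h]
    have h2 := (Finset.card_le_card h1).trans Finset.card_le_two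
    have h3 : (Finset.filter (fun y => Quotient.mk (SameCycle.setoid τ) y = Quotient.mk _ x)
        (Finset.univ.filter fun x => τ x = x)) = ∅ := by
      refine Finset.eq_empty_of_forall_notMem fun y hy => ?_
      rw [Finset.mem_filter, Finset.mem_filter] at hy
      obtain ⟨⟨-, hy⟩, h⟩ := hy
      rcases hsub y h with rfl | rfl
      · exact hx hy
      · exact hx (by rw [hτ] at hy; exact hy.symm)
    rw [h3, Finset.card_empty]
    exact h2

/-- Two fixed-point free involutions have a common proper two-colouring. -/
theorem exists_coloring_of_involutions {α : Type*} (f p : Equiv.Perm α) (hf : ∀ x, f (f x) = x)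
    (hp : ∀ x, p (p x) = x) (hf' : ∀ x, f x ≠ x) (hp' : ∀ x, p x ≠ x) :
    ∃ o : α → Bool, ∀ x, o (f x) = !o x ∧ o (p x) = !o x := by
  classical
  have hff : f⁻¹ = f := by ext x; rw [Equiv.Perm.inv_eq_iff_eq, hf]
  have hpp : p⁻¹ = p := by ext x; rw [Equiv.Perm.inv_eq_iff_eq, hp]
  -- The dihedral relation: conjugation by `f` inverts `p * f`.
  have hconj : ∀ (j : ℤ) (x : α), f (((p * f) ^ j) x) = ((p * f) ^ (-j)) (f x) := by
    intro j x
    have h : f * (p * f) * f⁻¹ = (p * f)⁻¹ := by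
      rw [mul_inv_rev, hff, hpp]
      ext y
      simp [hf]
    have h2 : f * (p * f) ^ j * f⁻¹ = (p * f) ^ (-j) := by
      rw [← conj_zpow, h, inv_zpow, zpow_neg]
    rw [← h2]
    simp
  -- If `f x = (p * f) ^ i x`, the midpoint of the way from `x` to `f x` would be fixed by `f` (for
  -- `i` even) or by `p` (for `i` odd).
  have hne : ∀ x, ¬ (SameCycle.setoid (p * f)) x (f x) := by
    rintro x ⟨i, hi⟩
    obtain ⟨j, rfl | rfl⟩ := Int.even_or_odd' i
    · refine hf' (((p * f) ^ j) x) ?_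
      rw [hconj, ← hi, ← Equiv.Perm.mul_apply, ← zpow_add]
      congr 2
      ring
    · refine hp' (((p * f) ^ (j + 1)) x) ?_
      have h1 : p (((p * f) ^ (j + 1)) x) = f (((p * f) ^ j) x) := by
        rw [add_comm, zpow_add, zpow_one]
        simp [hp]
      rw [h1, hconj, ← hi, ← Equiv.Perm.mul_apply, ← zpow_add]
      congr 2
      ring
  let Q := Quotient (SameCycle.setoid (p * f))
  let φ : Q → Q := Quotient.map f (by
    rintro x _ ⟨i, rfl⟩
    exact ⟨-i, (hconj i x).symm⟩)
  have hφ : ∀ q, φ (φ q) = q := by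
    intro q
    induction q using Quotient.inductionOn with | _ x
    exact congrArg (Quotient.mk _) (hf x)
  have hφ' : ∀ q, φ q ≠ q := by
    intro q
    induction q using Quotient.inductionOn with | _ x
    intro h
    exact hne x (Quotient.exact h.symm)
  -- `f` permutes the cycles of `p * f` in pairs. An arbitrary linear order distinguishes the two
  -- members of each pair, and `p` induces the same pairing.
  let _ : LinearOrder Q := linearOrderOfSTO WellOrderingRel
  let o : Q → Bool := fun q => decide (q < φ q)
  have ho : ∀ q, o (φ q) = !o q := by
    intro q
    simp only [o, hφ]
    rcases lt_or_gt_of_ne (hφ' q) with h | h <;> simp [h, not_lt.2 h.le]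
  refine ⟨fun x => o (Quotient.mk _ x), fun x => ⟨ho (Quotient.mk _ x), ?_⟩⟩
  refine Eq.trans ?_ (ho (Quotient.mk _ x))
  refine congrArg o (Quotient.sound ⟨-1, ?_⟩)
  rw [zpow_neg_one, Equiv.Perm.inv_eq_iff_eq]
  simp [hf]

end Equiv.Perm

/-! ### Vertices and points of the sphere -/

namespace SphereMap

variable {H : Type*} [Fintype H] [DecidableEq H] (M : SphereMap H)

theorem vertex_eq_iff {d e : H} : M.vertex d = M.vertex e ↔ M.rot.SameCycle d e :=
  ⟨fun h => Quotient.exact h, fun h => Quotient.sound (s := Equiv.Perm.SameCycle.setoid M.rot) h⟩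

theorem vertex_someDart (v : M.Vertex) : M.vertex (M.someDart v) = v := Quotient.out_eq v

theorem exists_vertex_eq (v : M.Vertex) : ∃ d, M.vertex d = v := ⟨_, M.vertex_someDart v⟩

instance : Finite M.Vertex := Finite.of_surjective M.vertex M.exists_vertex_eq

theorem vertex_rot (d : H) : M.vertex (M.rot d) = M.vertex d := LinkDiagram.vertex_rot M d

theorem rot_rot_inv (d : H) : M.rot (M.rot⁻¹ d) = d := M.rot.apply_symm_apply d

theorem rot_inv_rot (d : H) : M.rot⁻¹ (M.rot d) = d := M.rot.symm_apply_apply d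

theorem vertex_rot_inv (d : H) : M.vertex (M.rot⁻¹ d) = M.vertex d := by
  rw [← M.vertex_rot, M.rot_rot_inv]

theorem vertex_rot_pow (n : ℕ) (d : H) : M.vertex ((M.rot ^ n) d) = M.vertex d := by
  induction n with
  | zero => rfl
  | succ n ih => rw [pow_succ', Equiv.Perm.mul_apply, M.vertex_rot, ih]

theorem exists_pow_of_vertex_eq {d e : H} (h : M.vertex d = M.vertex e) :
    ∃ n : ℕ, (M.rot ^ n) d = e := by
  obtain ⟨n, -, -, h⟩ := ((M.vertex_eq_iff).1 h).exists_pow_eq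
  exact ⟨n, h⟩

theorem pt_zero_left (d : H) (t : I) : M.pt d 0 t = M.pt (M.rot d) t 0 :=
  Quot.sound (Glue.halfEdge d t)

theorem pt_one_left (d : H) (t : I) : M.pt d 1 t = M.pt (M.rot⁻¹ (M.flip d)) t 1 :=
  Quot.sound (Glue.midline d t)

theorem pt_zero_zero {d e : H} (h : M.vertex d = M.vertex e) : M.pt d 0 0 = M.pt e 0 0 := by
  obtain ⟨n, rfl⟩ := M.exists_pow_of_vertex_eq h
  clear h
  induction n with
  | zero => rfl
  | succ n ih => rw [ih, pow_succ', Equiv.Perm.mul_apply, M.pt_zero_left]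

theorem exists_pt (p : M.Sphere) : ∃ d x y, p = M.pt d x y := by
  induction p using Quot.inductionOn with | _ p
  exact ⟨p.1, p.2.1, p.2.2, rfl⟩

theorem continuous_pt (d : H) : Continuous fun p : I × I => M.pt d p.1 p.2 :=
  have h : Continuous fun p : I × I => (⟨d, p⟩ : Σ _ : H, I × I) :=
    @continuous_sigmaMk H (fun _ => I × I) _ d
  continuous_quot_mk.comp h

theorem pt_mem_openDisc_iff {d : H} {x y : I} {v : M.Vertex} :
    M.pt d x y ∈ M.openDisc v ↔ (x : ℝ) + y < 1 / 2 ∧ M.vertex d = v := by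
  let P : M.Sphere → Prop :=
    Quot.lift (fun p => ((p.2.1 : ℝ) + p.2.2 < 1 / 2 ∧ M.vertex p.1 = v)) (by
      rintro _ _ (⟨d, t⟩ | ⟨d, t⟩)
      · simp [M.vertex_rot]
      -- The midline gluing only concerns points with a coordinate `1`, which are outside every
      -- disc.
      · have := t.2.1
        have h1 : ¬ ((1 : ℝ) + t < 1 / 2) := by linarith
        have h2 : ¬ ((t : ℝ) + 1 < 1 / 2) := by linarith
        simp only [Set.Icc.coe_one, h1, h2, false_and])
  constructor
  · rintro ⟨e, x', y', he, hxy, h⟩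
    have : P (M.pt e x' y') := ⟨hxy, he⟩
    rwa [← h] at this
  · rintro ⟨h1, h2⟩
    exact ⟨d, x, y, h2, h1, rfl⟩

end SphereMap

namespace LinkDiagram

variable {H : Type*} [Fintype H] [DecidableEq H] {M : SphereMap H} (D : LinkDiagram M)

/-! ### Darts at a crossing -/

theorem mem_strand_of_isCrossing {d : H} (h : D.IsCrossing (M.vertex d)) : d ∈ D.strand :=
  D.full d h

theorem ncard_darts_of_isCrossing {v : M.Vertex} (h : D.IsCrossing v) :
    {d | M.vertex d = v}.ncard = 4 := by
  rw [← show _ = 4 from h]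
  congr 1
  ext d
  exact ⟨fun hd => ⟨D.full d (by rw [← show _ = v from hd] at h; exact h), hd⟩, fun hd => hd.2⟩

theorem rot_pow_four {d : H} (h : D.IsCrossing (M.vertex d)) : (M.rot ^ 4) d = d := by
  have h4 := D.ncard_darts_of_isCrossing h
  -- A fixed dart has a trivial `cycleOf` with empty support, so the count of the support needs
  -- `M.rot d ≠ d`.
  by_cases hd : M.rot d = d
  · simp [pow_succ, hd]
  have hs : ((M.rot.cycleOf d).support : Set H) = {e | M.vertex e = M.vertex d} := by
    ext e
    rw [Finset.mem_coe, Equiv.Perm.mem_support_cycleOf_iff' hd, Set.mem_ofPred_eq,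
      M.vertex_eq_iff, Equiv.Perm.sameCycle_comm]
  rw [← hs, Set.ncard_coe_finset] at h4
  have := Equiv.Perm.pow_mod_card_support_cycleOf_self_apply M.rot 4 d
  rw [h4] at this
  simpa using this.symm

theorem rot_sq_rot_sq {d : H} (h : D.IsCrossing (M.vertex d)) :
    (M.rot ^ 2) ((M.rot ^ 2) d) = d := by
  rw [← Equiv.Perm.mul_apply, ← pow_add]
  exact D.rot_pow_four h

/-! ### The regions as classes of sectors -/

/-- The sectors `d` and `e` belong to the same region: they are consecutive sectors of a face, or are
separated by a half-edge outside the projection, or are joined by a band. -/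
def RegionStep (X : Set M.Vertex) (d e : H) : Prop :=
  e = M.rot⁻¹ (M.flip d) ∨ (e = M.rot d ∧ e ∉ D.strand) ∨
    (M.vertex d ∈ X ∧ e = (M.rot ^ 2) d)

/-- The region of a sector. -/
def region (X : Set M.Vertex) (d : H) : Quot (D.RegionStep X) := Quot.mk _ d

theorem region_face (X : Set M.Vertex) (d : H) :
    D.region X (M.rot⁻¹ (M.flip d)) = D.region X d :=
  (Quot.sound (r := D.RegionStep X) (Or.inl rfl)).symm

theorem region_rot {X : Set M.Vertex} {d : H} (h : M.rot d ∉ D.strand) :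
    D.region X (M.rot d) = D.region X d :=
  (Quot.sound (r := D.RegionStep X) (Or.inr (Or.inl ⟨rfl, h⟩))).symm

theorem region_rot_sq {X : Set M.Vertex} {d : H} (h : M.vertex d ∈ X) :
    D.region X ((M.rot ^ 2) d) = D.region X d :=
  (Quot.sound (r := D.RegionStep X) (Or.inr (Or.inr ⟨h, rfl⟩))).symm

/-- The point with coordinates `p.2` in the square of the dart `p.1` lies in the projection. -/
def OnProjection (p : Σ _ : H, I × I) : Prop :=
  (p.2.2 = 0 ∧ p.1 ∈ D.strand) ∨ (p.2.1 = 0 ∧ M.rot p.1 ∈ D.strand) ∨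
    (p.2.1 = 0 ∧ p.2.2 = 0 ∧ ∃ e ∈ D.strand, M.vertex e = M.vertex p.1)

theorem flip_mem_strand_iff {d : H} : M.flip d ∈ D.strand ↔ d ∈ D.strand :=
  ⟨fun h => by simpa [M.flip_flip] using D.strand_flip _ h, D.strand_flip d⟩

/-- The third alternative of `OnProjection` is needed here: a vertex on the projection must be seen
from every sector at it, including sectors with no side in the projection. -/
theorem onProjection_congr {p q : Σ _ : H, I × I} (h : M.Glue p q) :
    D.OnProjection p ↔ D.OnProjection q := by
  rcases h with ⟨d, t⟩ | ⟨d, t⟩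
  · simp only [OnProjection, M.vertex_rot, true_and]
    constructor
    · rintro (⟨ht, hd⟩ | h | h)
      · exact Or.inr (Or.inr ⟨ht, d, hd, rfl⟩)
      · exact Or.inl h
      · exact Or.inr (Or.inr h)
    · rintro (h | ⟨ht, hd⟩ | h)
      · exact Or.inr (Or.inl h)
      · exact Or.inr (Or.inr ⟨ht, _, hd, by rw [M.vertex_rot, M.vertex_rot]⟩)
      · exact Or.inr (Or.inr ⟨h.1, h.2⟩)
  · simp [OnProjection, D.flip_mem_strand_iff]

theorem pt_mem_projection_iff {d : H} {x y : I} :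
    M.pt d x y ∈ D.projection ↔ D.OnProjection ⟨d, (x, y)⟩ := by
  constructor
  · rintro ⟨e, he, t, h⟩
    have : (Quot.lift D.OnProjection fun _ _ h => propext (D.onProjection_congr h)) (M.pt e t 0) :=
      Or.inl ⟨rfl, he⟩
    rwa [← h] at this
  · rintro (⟨h, hd⟩ | ⟨h, hd⟩ | ⟨h, h', e, he, hv⟩)
    · exact ⟨d, hd, x, by rw [show y = 0 from h]⟩
    · exact ⟨_, hd, y, by rw [show x = 0 from h, M.pt_zero_left]⟩
    · exact ⟨e, he, 0, by rw [show x = 0 from h, show y = 0 from h', M.pt_zero_zero hv]⟩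

/-- The part of the region `c` in the sphere. -/
def InRegion (X : Set M.Vertex) (c : Quot (D.RegionStep X)) : M.Sphere → Prop :=
  Quot.lift (fun p => ¬ D.OnProjection p ∧ D.region X p.1 = c) (by
    intro p q h
    refine propext ?_
    rw [D.onProjection_congr h]
    refine and_congr_right fun hq => ?_
    rcases h with ⟨d, t⟩ | ⟨d, t⟩
    · have : M.rot d ∉ D.strand := fun h => hq ((D.onProjection_congr (.halfEdge d t)).1
        (Or.inr (Or.inl ⟨rfl, h⟩)))
      rw [D.region_rot this]
    · rw [D.region_face])

theorem inRegion_pt {X : Set M.Vertex} {c : Quot (D.RegionStep X)} {d : H} {x y : I} :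
    D.InRegion X c (M.pt d x y) ↔ ¬ D.OnProjection ⟨d, (x, y)⟩ ∧ D.region X d = c := Iff.rfl

theorem isOpen_inRegion (X : Set M.Vertex) (c : Quot (D.RegionStep X)) :
    IsOpen {p | D.InRegion X c p} := by
  refine isOpen_coinduced.2 (isOpen_sigma_iff.2 fun d => ?_)
  have hclosed : IsClosed {p : I × I | D.OnProjection ⟨d, p⟩} := by
    refine IsClosed.union ?_ (IsClosed.union ?_ ?_)
    · exact (isClosed_eq continuous_snd continuous_const).inter (isClosed_const (p := d ∈ D.strand))
    · exact (isClosed_eq continuous_fst continuous_const).inter (isClosed_const (p := M.rot d ∈ D.strand))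
    · exact (isClosed_eq continuous_fst continuous_const).inter
        ((isClosed_eq continuous_snd continuous_const).inter (isClosed_const (p := ∃ e ∈ D.strand, M.vertex e = M.vertex d)))
  exact hclosed.isOpen_compl.inter (isOpen_const (p := D.region X d = c))

/-- At a crossing both sides of every sector are strands, so precisely the two endpoints of the arc
are on the projection. -/
theorem inRegion_arcPt {X : Set M.Vertex} {c : Quot (D.RegionStep X)} {d : H}
    (hd : D.IsCrossing (M.vertex d)) (t : I) :
    D.InRegion X c (M.arcPt d t) ↔ (t ≠ 0 ∧ t ≠ 1) ∧ D.region X d = c := by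
  have hd1 := D.mem_strand_of_isCrossing hd
  have hd2 := D.mem_strand_of_isCrossing (d := M.rot d) (by rwa [M.vertex_rot])
  rw [SphereMap.arcPt, inRegion_pt]
  refine and_congr_left fun _ => ?_
  simp only [OnProjection, hd1, hd2, and_true, ← Subtype.coe_inj, Set.Icc.coe_zero]
  have h1 : (t : ℝ) / 2 = 0 ↔ (t : ℝ) = 0 := by constructor <;> intro h <;> linarith
  have h2 : (1 - (t : ℝ)) / 2 = 0 ↔ (t : ℝ) = 1 := by constructor <;> intro h <;> linarith
  rw [ne_eq, ne_eq, ← not_or, not_iff_not, h1, h2, ← Subtype.coe_inj, ← Subtype.coe_inj,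
    Set.Icc.coe_zero, Set.Icc.coe_one]
  constructor
  · rintro (h | h | h)
    · exact Or.inl h
    · exact Or.inr h
    · exact Or.inl h.2.1
  · rintro (h | h)
    · exact Or.inl h
    · exact Or.inr (Or.inl h)

/-- The region `c` in the surface. -/
def InSurgeryRegion {X : Set M.Vertex} (hX : ∀ v ∈ X, D.IsCrossing v)
    (c : Quot (D.RegionStep X)) : M.Surgery X → Prop :=
  Quot.lift (Sum.elim (fun p => D.InRegion X c p.1) (fun p => (p.2.2 ≠ 0 ∧ p.2.2 ≠ 1) ∧
      D.region X ((M.rot ^ (p.1.2 : ℕ)) (M.someDart p.1.1)) = c)) (by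
    have hv : ∀ (v : X) (n : ℕ), M.vertex ((M.rot ^ n) (M.someDart v)) = v := fun v n => by
      rw [M.vertex_rot_pow, M.vertex_someDart]
    rintro _ _ (⟨v, i, t⟩ | ⟨v, i, t⟩)
    · refine propext (D.inRegion_arcPt ?_ t).symm
      rw [hv]
      exact hX v v.2
    · refine propext (Iff.trans ?_ (D.inRegion_arcPt ?_ (unitInterval.symm t)).symm)
      · rw [add_comm, pow_add, Equiv.Perm.mul_apply, D.region_rot_sq (by rw [hv]; exact v.2)]
        simp [and_comm]
      · rw [hv]
        exact hX v v.2)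

/-! ### The regions as disjoint open sets covering the complement of the graph. -/

section Surface

variable {X : Set M.Vertex} (hX : ∀ v ∈ X, D.IsCrossing v)
include hX

theorem isOpen_inSurgeryRegion (c : Quot (D.RegionStep X)) :
    IsOpen {q | D.InSurgeryRegion hX c q} := by
  refine isOpen_coinduced.2 (isOpen_sum_iff.2 ⟨?_, isOpen_sigma_iff.2 fun b => ?_⟩)
  · exact (D.isOpen_inRegion X c).preimage continuous_subtype_val
  · refine IsOpen.inter (s := {p : I × I | p.2 ≠ 0 ∧ p.2 ≠ 1}) ?_
      (isOpen_const (p := D.region X ((M.rot ^ (b.2 : ℕ)) (M.someDart b.1)) = c))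
    exact (isOpen_ne_fun continuous_snd continuous_const).inter
      (isOpen_ne_fun continuous_snd continuous_const)

theorem inSurgeryRegion_unique {c c' : Quot (D.RegionStep X)} {q : M.Surgery X}
    (h : D.InSurgeryRegion hX c q) (h' : D.InSurgeryRegion hX c' q) : c = c' := by
  induction q using Quot.inductionOn with | _ q
  rcases q with ⟨p, hp⟩ | p
  · obtain ⟨d, x, y, rfl⟩ := M.exists_pt p
    exact h.2.symm.trans h'.2
  · exact h.2.symm.trans h'.2

theorem notMem_graph_iff {q : M.Surgery X} :
    q ∉ D.graph X ↔ ∃ c, D.InSurgeryRegion hX c q := by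
  constructor
  · intro hq
    induction q using Quot.inductionOn with | _ q
    rcases q with ⟨p, hp⟩ | ⟨b, s, t⟩
    · obtain ⟨d, x, y, rfl⟩ := M.exists_pt p
      exact ⟨D.region X d, fun h => hq (Or.inl ⟨⟨_, hp⟩, D.pt_mem_projection_iff.2 h, rfl⟩), rfl⟩
    · exact ⟨_, ⟨fun h => hq (Or.inr ⟨b, s, t, Or.inl h, rfl⟩),
        fun h => hq (Or.inr ⟨b, s, t, Or.inr h, rfl⟩)⟩, rfl⟩
  · rintro ⟨c, hc⟩ (⟨⟨p, hp⟩, hpp, rfl⟩ | ⟨b, s, t, h, rfl⟩)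
    · obtain ⟨d, x, y, rfl⟩ := M.exists_pt p
      exact hc.1 (D.pt_mem_projection_iff.1 hpp)
    · exact h.elim hc.1.1 hc.1.2

end Surface

/-- The image in the surface of a point outside the removed discs. -/
def surgeryPt (X : Set M.Vertex) (d : H) (x y : I)
    (h : ∀ v ∈ X, M.pt d x y ∉ M.openDisc v) : M.Surgery X :=
  Quot.mk _ (Sum.inl ⟨M.pt d x y, h⟩)

theorem pt_notMem_openDisc {d : H} {x y : I} (h : (1 : ℝ) / 2 ≤ x + y) (v : M.Vertex) :
    M.pt d x y ∉ M.openDisc v := fun h' => by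
  have := (M.pt_mem_openDisc_iff.1 h').1
  linarith

/-- The centre of the face to the left of `d`, in the surface. -/
def faceCentre (M : SphereMap H) (X : Set M.Vertex) (d : H) : M.Surgery X :=
  surgeryPt X d 1 1 fun v _ => pt_notMem_openDisc (by norm_num) v

theorem joinedIn_of_continuous {α : Type*} [TopologicalSpace α] {F : Set α} {f : I → α}
    (hf : Continuous f) (h : ∀ t, f t ∈ F) : JoinedIn F (f 0) (f 1) :=
  ⟨⟨⟨f, hf⟩, rfl, rfl⟩, h⟩

/-! ### Paths in the complement of the graph, and its connected components. -/

section Paths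

variable {X : Set M.Vertex} (hX : ∀ v ∈ X, D.IsCrossing v)
include hX

theorem joinedIn_faceCentre {d : H} {x y : I} (h : ∀ v ∈ X, M.pt d x y ∉ M.openDisc v)
    (hp : ¬ D.OnProjection ⟨d, (x, y)⟩) :
    JoinedIn (D.graph X)ᶜ (surgeryPt X d x y h) (faceCentre M X d) := by
  have hdisc : ∀ t : I, ∀ v ∈ X, M.pt d (x ⊔ t) (y ⊔ t) ∉ M.openDisc v := by
    intro t v hv h'
    obtain ⟨h1, h2⟩ := M.pt_mem_openDisc_iff.1 h'
    refine h v hv (M.pt_mem_openDisc_iff.2 ⟨?_, h2⟩)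
    have hx : (x : ℝ) ≤ (x ⊔ t : I) := Subtype.coe_le_coe.2 le_sup_left
    have hy : (y : ℝ) ≤ (y ⊔ t : I) := Subtype.coe_le_coe.2 le_sup_left
    linarith
  -- Raising both coordinates to at least `t` never decreases their sum, so the path does not enter
  -- a disc. For `t > 0` both coordinates are positive, so it is off the projection.
  have key := joinedIn_of_continuous (F := (D.graph X)ᶜ)
    (f := fun t => surgeryPt X d (x ⊔ t) (y ⊔ t) (hdisc t)) ?_ ?_
  · convert key using 1
    · congr 1 <;> exact (sup_of_le_left unitInterval.nonneg').symm
    · unfold faceCentre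
      congr 1 <;> exact (sup_of_le_right unitInterval.le_one').symm
  · refine continuous_quot_mk.comp (continuous_inl.comp (Continuous.subtype_mk ?_ _))
    exact (M.continuous_pt d).comp ((continuous_const.sup continuous_id).prodMk
      (continuous_const.sup continuous_id))
  · intro t
    refine (D.notMem_graph_iff hX).2 ⟨D.region X d, ?_, rfl⟩
    by_cases ht : t = 0
    · subst ht
      rwa [sup_of_le_left unitInterval.nonneg', sup_of_le_left unitInterval.nonneg']
    · have hpos : 0 < t := unitInterval.pos_iff_ne_zero.2 ht
      have h1 : x ⊔ t ≠ 0 := (hpos.trans_le le_sup_right).ne'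
      have h2 : y ⊔ t ≠ 0 := (hpos.trans_le le_sup_right).ne'
      simp [OnProjection, h1, h2]

theorem joinedIn_band {v : X} {i : Fin 2} {s s' t : I} (ht : t ≠ 0 ∧ t ≠ 1) :
    JoinedIn (D.graph X)ᶜ (Quot.mk (M.BandGlue X) (Sum.inr ⟨(v, i), (s, t)⟩))
      (Quot.mk (M.BandGlue X) (Sum.inr ⟨(v, i), (s', t)⟩)) := by
  have hmem : ∀ s, (Quot.mk (M.BandGlue X) (Sum.inr ⟨(v, i), (s, t)⟩)) ∈ (D.graph X)ᶜ :=
    fun s => (D.notMem_graph_iff hX).2 ⟨_, ht, rfl⟩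
  have hmk : Continuous fun p : I × I => (⟨(v, i), p⟩ : Σ _ : X × Fin 2, I × I) :=
    @continuous_sigmaMk (X × Fin 2) (fun _ => I × I) _ (v, i)
  have hcont : Continuous fun s : I =>
      (Quot.mk (M.BandGlue X) (Sum.inr ⟨(v, i), (s, t)⟩) : M.Surgery X) :=
    continuous_quot_mk.comp (continuous_inr.comp
      (hmk.comp (continuous_id.prodMk continuous_const)))
  have h0 : ∀ s, JoinedIn (D.graph X)ᶜ (Quot.mk (M.BandGlue X) (Sum.inr ⟨(v, i), (0, t)⟩))
      (Quot.mk (M.BandGlue X) (Sum.inr ⟨(v, i), (s, t)⟩)) := by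
    intro s
    have := joinedIn_of_continuous (F := (D.graph X)ᶜ)
      (hcont.comp (continuous_const.inf continuous_id : Continuous fun a : I => s ⊓ a))
      (fun a => hmem _)
    simpa [min_eq_left (unitInterval.le_one' (t := s))] using this
  exact (h0 s).symm.trans (h0 s')

theorem joinedIn_arc {v : M.Vertex} {d : H} (hv : v ∈ X) (hd : M.vertex d = v) {t : I}
    (ht : t ≠ 0 ∧ t ≠ 1) :
    JoinedIn (D.graph X)ᶜ (Quot.mk (M.BandGlue X) (Sum.inl (M.cutArc X d t)))
      (faceCentre M X d) := by
  refine D.joinedIn_faceCentre hX (fun v _ => M.arcPt_notMem d t v) ?_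
  exact ((D.inRegion_arcPt (X := X) (by rw [hd]; exact hX v hv) t).2 ⟨ht, rfl⟩).1

/-- Every point outside the graph is joined to the centre of a face of its region. -/
theorem exists_joinedIn_faceCentre {q : M.Surgery X} {c : Quot (D.RegionStep X)}
    (hq : D.InSurgeryRegion hX c q) :
    ∃ d, D.region X d = c ∧ JoinedIn (D.graph X)ᶜ q (faceCentre M X d) := by
  induction q using Quot.inductionOn with | _ q
  rcases q with ⟨p, hp⟩ | ⟨⟨v, i⟩, s, t⟩
  · obtain ⟨d, x, y, rfl⟩ := M.exists_pt p
    exact ⟨d, hq.2, D.joinedIn_faceCentre hX hp hq.1⟩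
  · refine ⟨_, hq.2, (D.joinedIn_band hX (s' := 0) hq.1).trans ?_⟩
    rw [Quot.sound (SphereMap.BandGlue.left v i t)]
    exact D.joinedIn_arc hX v.2 (by rw [M.vertex_rot_pow, M.vertex_someDart]) hq.1

theorem joinedIn_faceCentre_rot_sq {d : H} (hd : M.vertex d ∈ X) :
    JoinedIn (D.graph X)ᶜ (faceCentre M X d) (faceCentre M X ((M.rot ^ 2) d)) := by
  have ht : (⟨1 / 2, by norm_num, by norm_num⟩ : I) ≠ 0 ∧
      (⟨1 / 2, by norm_num, by norm_num⟩ : I) ≠ 1 := by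
    constructor <;> intro h <;> have := congrArg Subtype.val h <;> norm_num at this
  have ht' : unitInterval.symm (⟨1 / 2, by norm_num, by norm_num⟩ : I) ≠ 0 ∧
      unitInterval.symm (⟨1 / 2, by norm_num, by norm_num⟩ : I) ≠ 1 := by
    simpa [and_comm] using ht
  have key : ∀ (v : X) (i : Fin 2), JoinedIn (D.graph X)ᶜ
      (faceCentre M X ((M.rot ^ (i : ℕ)) (M.someDart v)))
      (faceCentre M X ((M.rot ^ ((i : ℕ) + 2)) (M.someDart v))) := by
    intro v i
    have h1 := D.joinedIn_arc hX v.2 (d := (M.rot ^ (i : ℕ)) (M.someDart v))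
      (by rw [M.vertex_rot_pow, M.vertex_someDart]) ht
    have h2 := D.joinedIn_arc hX v.2 (d := (M.rot ^ ((i : ℕ) + 2)) (M.someDart v))
      (by rw [M.vertex_rot_pow, M.vertex_someDart]) ht'
    rw [← Quot.sound (SphereMap.BandGlue.left v i _)] at h1
    rw [← Quot.sound (SphereMap.BandGlue.right v i _)] at h2
    exact (h1.symm.trans (D.joinedIn_band hX ht)).trans h2
  set v : X := ⟨M.vertex d, hd⟩
  have hv : D.IsCrossing (M.vertex (M.someDart v)) := by
    rw [M.vertex_someDart]
    exact hX v v.2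
  obtain ⟨n, hn⟩ := M.exists_pow_of_vertex_eq (d := M.someDart v) (e := d) (M.vertex_someDart v)
  have hper : ∀ j, (M.rot ^ (4 * j)) (M.someDart v) = M.someDart v := by
    intro j
    induction j with
    | zero => rfl
    | succ j ih => rw [mul_add, pow_add, Equiv.Perm.mul_apply, mul_one, D.rot_pow_four hv, ih]
  -- The bands are indexed from `someDart v`, so `d` is located relative to it. Band `0` joins
  -- sectors `0` and `2`, band `1` joins `1` and `3`; the last two cases use a band backwards.
  have hmod : (M.rot ^ (n % 4)) (M.someDart v) = d := by
    rw [← hn]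
    conv_rhs => rw [← Nat.mod_add_div n 4, pow_add, Equiv.Perm.mul_apply, hper]
  have hlt := Nat.mod_lt n (show 0 < 4 by norm_num)
  have h0 := key v 0
  have h1 := key v 1
  rw [← hmod, ← Equiv.Perm.mul_apply, ← pow_add]
  have h4 : (M.rot ^ (2 + 2)) (M.someDart v) = (M.rot ^ 0) (M.someDart v) := D.rot_pow_four hv
  have h5 : (M.rot ^ (2 + 3)) (M.someDart v) = (M.rot ^ 1) (M.someDart v) := by
    rw [show 2 + 3 = 1 + 4 from rfl, pow_add, Equiv.Perm.mul_apply, D.rot_pow_four hv]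
  generalize n % 4 = m at hlt
  interval_cases m
  · exact h0
  · exact h1
  · rw [h4]
    exact h0.symm
  · rw [h5]
    exact h1.symm

theorem joinedIn_of_region_eq {d e : H} (h : D.region X d = D.region X e) :
    JoinedIn (D.graph X)ᶜ (faceCentre M X d) (faceCentre M X e) := by
  have hrefl : ∀ d, JoinedIn (D.graph X)ᶜ (faceCentre M X d) (faceCentre M X d) :=
    fun d => JoinedIn.refl ((D.notMem_graph_iff hX).2
      ⟨D.region X d, by simp [OnProjection], rfl⟩)
  replace h := Quot.eqvGen_exact h
  induction h with
  | refl => exact hrefl _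
  | symm _ _ _ ih => exact ih.symm
  | trans _ _ _ _ _ ih ih' => exact ih.trans ih'
  | rel d e h' =>
    rcases h' with rfl | ⟨rfl, h'⟩ | ⟨h', rfl⟩
    · have : faceCentre M X (M.rot⁻¹ (M.flip d)) = faceCentre M X d :=
        congrArg (fun p => Quot.mk _ (Sum.inl p)) (Subtype.ext (M.pt_one_left d 1).symm)
      rw [this]
      exact hrefl d
    · have hd1 : ∀ v ∈ X, M.pt d 0 1 ∉ M.openDisc v := fun v _ =>
        pt_notMem_openDisc (by norm_num) v
      have hd2 : ∀ v ∈ X, M.pt (M.rot d) 1 0 ∉ M.openDisc v := fun v _ =>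
        pt_notMem_openDisc (by norm_num) v
      have heq : surgeryPt X d 0 1 hd1 = surgeryPt X (M.rot d) 1 0 hd2 :=
        congrArg (fun p => Quot.mk _ (Sum.inl p)) (Subtype.ext (M.pt_zero_left d 1))
      have h1 := D.joinedIn_faceCentre hX hd1 (by simp [OnProjection, h'])
      have h2 := D.joinedIn_faceCentre hX hd2 (by simp [OnProjection, h'])
      rw [heq] at h1
      exact h1.symm.trans h2
    · exact D.joinedIn_faceCentre_rot_sq hX h'

/-- The connected components of the complement of the graph are the classes of sectors. -/
theorem regions_eq : D.regions X = Nat.card (Quot (D.RegionStep X)) := by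
  -- With the discrete topology on classes, the map from points to their region is continuous
  -- because regions are open. It separates components because points of one region are joined by
  -- paths.
  let _ : TopologicalSpace (Quot (D.RegionStep X)) := ⊥
  have : DiscreteTopology (Quot (D.RegionStep X)) := ⟨rfl⟩
  choose F hF using fun q : ↥(D.graph X)ᶜ => (D.notMem_graph_iff hX).1 q.2
  have hcont : Continuous F := by
    rw [continuous_discrete_rng]
    intro c
    convert (D.isOpen_inSurgeryRegion hX c).preimage continuous_subtype_val using 1
    ext q
    exact ⟨fun h => by rw [← show F q = c from h]; exact hF q,
      fun h => D.inSurgeryRegion_unique hX (hF q) h⟩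
  refine Nat.card_congr (Equiv.ofBijective hcont.connectedComponentsLift ⟨?_, ?_⟩)
  · intro a b hab
    obtain ⟨q, rfl⟩ := ConnectedComponents.surjective_coe a
    obtain ⟨q', rfl⟩ := ConnectedComponents.surjective_coe b
    rw [hcont.connectedComponentsLift_apply_coe, hcont.connectedComponentsLift_apply_coe] at hab
    obtain ⟨d, hd, hdq⟩ := D.exists_joinedIn_faceCentre hX (hF q)
    obtain ⟨e, he, heq⟩ := D.exists_joinedIn_faceCentre hX (hF q')
    have h := (hdq.trans (D.joinedIn_of_region_eq hX (hd.trans (hab.trans he.symm)))).trans heq.symm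
    have hj := h.joined_subtype
    rw [ConnectedComponents.coe_eq_coe]
    exact (connectedComponent_eq (pathComponent_subset_component q hj)).symm.symm
  · intro c
    induction c using Quot.inductionOn with | _ d
    have hd : D.InSurgeryRegion hX (D.region X d) (faceCentre M X d) :=
      ⟨by simp [OnProjection], rfl⟩
    refine ⟨ConnectedComponents.mk ⟨faceCentre M X d, (D.notMem_graph_iff hX).2 ⟨_, hd⟩⟩, ?_⟩
    exact D.inSurgeryRegion_unique hX (hF _) hd

end Paths

end LinkDiagram

namespace LinkDiagram

variable {H : Type*} [Fintype H] [DecidableEq H] {M : SphereMap H} (D : LinkDiagram M)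

/-! ### Two-colourings of the sectors at the vertices -/

/-- A vertex on the projection that is not a crossing has valence `2`. -/
theorem exists_partner {d : H} (hd : d ∈ D.strand) (hc : ¬ D.IsCrossing (M.vertex d)) :
    ∃ e ∈ D.strand, e ≠ d ∧ M.vertex e = M.vertex d ∧
      ∀ e' ∈ D.strand, M.vertex e' = M.vertex d → e' = d ∨ e' = e := by
  have hval := D.valence (M.vertex d)
  have hmem : d ∈ {e | e ∈ D.strand ∧ M.vertex e = M.vertex d} := ⟨hd, rfl⟩
  have h0 : {e | e ∈ D.strand ∧ M.vertex e = M.vertex d}.ncard ≠ 0 :=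
    ((Set.ncard_pos (Set.toFinite _)).2 ⟨d, hmem⟩).ne'
  have h2 : {e | e ∈ D.strand ∧ M.vertex e = M.vertex d}.ncard = 2 := by
    rcases hval with h | h | h
    · exact absurd h h0
    · exact h
    · exact absurd h hc
  obtain ⟨a, b, hab, hs⟩ := Set.ncard_eq_two.1 h2
  have ha : a ∈ {e | e ∈ D.strand ∧ M.vertex e = M.vertex d} := by simp [hs]
  have hb : b ∈ {e | e ∈ D.strand ∧ M.vertex e = M.vertex d} := by simp [hs]
  have hall : ∀ e' ∈ D.strand, M.vertex e' = M.vertex d → e' = a ∨ e' = b := by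
    intro e' h1 h2
    have : e' ∈ {e | e ∈ D.strand ∧ M.vertex e = M.vertex d} := ⟨h1, h2⟩
    rwa [hs] at this
  rcases hall d hd rfl with rfl | rfl
  · exact ⟨b, hb.1, hab.symm, hb.2, hall⟩
  · exact ⟨a, ha.1, hab, ha.2, fun e' h1 h2 => (hall e' h1 h2).symm⟩

/-- An arc of the projection that ends at a crossing also ends at another one (or at another
dart of the same crossing). -/
theorem exists_other_end {d : D.strand} (hd : D.IsCrossing (M.vertex d.1)) :
    ∃ e : D.strand, e ≠ d ∧ D.IsCrossing (M.vertex e.1) ∧ Relation.EqvGen D.ArcStep d e := by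
  classical
  by_contra! hno
  -- Parity argument: `flip` pairs off the darts of the arc, and partners pair off those at
  -- non-crossings, so the number of crossing ends is even and cannot be one.
  let C : Finset D.strand := Finset.univ.filter fun e => Relation.EqvGen D.ArcStep d e
  have hC : ∀ {e}, e ∈ C ↔ Relation.EqvGen D.ArcStep d e := by simp [C]
  have hstep : ∀ {e e'}, e ∈ C → D.ArcStep e e' → e' ∈ C :=
    fun h h' => hC.2 ((hC.1 h).trans _ _ _ (.rel _ _ h'))
  have h1 : ∑ _e ∈ C, (1 : ZMod 2) = 0 := by
    refine Finset.sum_involution (fun e _ => ⟨M.flip e.1, D.strand_flip _ e.2⟩)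
      (fun _ _ => by decide) (fun e _ _ h => M.flip_ne e.1 (congrArg Subtype.val h))
      (fun e he => hstep he (Or.inl rfl)) (fun e _ => Subtype.ext (M.flip_flip _))
  rw [← Finset.sum_filter_add_sum_filter_not C (fun e => D.IsCrossing (M.vertex e.1))] at h1
  have h2 : ∑ _e ∈ C with ¬ D.IsCrossing (M.vertex _e.1), (1 : ZMod 2) = 0 := by
    have hp : ∀ e : D.strand, ∃ e' : D.strand, ¬ D.IsCrossing (M.vertex e.1) →
        e' ≠ e ∧ M.vertex e'.1 = M.vertex e.1 ∧
        ∀ e'' : D.strand, M.vertex e''.1 = M.vertex e.1 → e'' = e ∨ e'' = e' := by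
      intro e
      by_cases he : D.IsCrossing (M.vertex e.1)
      · exact ⟨e, fun h => absurd he h⟩
      · obtain ⟨e', h, h', h'', h'''⟩ := D.exists_partner e.2 he
        exact ⟨⟨e', h⟩, fun _ => ⟨fun h => h' (congrArg Subtype.val h), h'', fun a ha =>
          (h''' a.1 a.2 ha).imp Subtype.ext Subtype.ext⟩⟩
    choose p hp using hp
    refine Finset.sum_involution (fun e _ => p e) (fun _ _ => by decide) ?_ ?_ ?_
    · intro e he _
      exact (hp e (Finset.mem_filter.1 he).2).1
    · intro e he
      obtain ⟨he1, he2⟩ := Finset.mem_filter.1 he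
      have h := hp e he2
      exact Finset.mem_filter.2 ⟨hstep he1 (Or.inr ⟨h.2.1.symm, he2⟩), by rwa [h.2.1]⟩
    · intro e he
      obtain ⟨he1, he2⟩ := Finset.mem_filter.1 he
      have h := hp e he2
      have h' := hp (p e) (by rwa [h.2.1])
      exact (h.2.2 (p (p e)) (h'.2.1.trans h.2.1)).resolve_right h'.1
  have h3 : (C.filter fun e => D.IsCrossing (M.vertex e.1)) = {d} := by
    ext e
    rw [Finset.mem_filter, Finset.mem_singleton, hC]
    constructor
    · rintro ⟨he, hec⟩
      by_contra hne
      exact hno e hne hec he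
    · rintro rfl
      exact ⟨.refl _, hd⟩
  rw [h2, h3, Finset.sum_singleton, add_zero] at h1
  exact one_ne_zero h1

/-- In an alternating diagram, the darts of the projection can be coloured such that over darts at
crossings have one colour, under darts the other, and the colours alternate along the projection
between crossings. -/
theorem exists_dart_coloring (halt : D.IsAlternating) :
    ∃ o : H → Bool, (∀ d ∈ D.strand, o (M.flip d) = !o d) ∧
      (∀ d ∈ D.strand, ∀ e ∈ D.strand, d ≠ e → M.vertex d = M.vertex e →
        ¬ D.IsCrossing (M.vertex d) → o e = !o d) ∧
      ∀ d, D.IsCrossing (M.vertex d) → (o d = true ↔ D.isOver d) := by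
  classical
  let P : D.strand → D.strand → Prop := fun d e => e ≠ d ∧
    ((M.vertex d.1 = M.vertex e.1 ∧ ¬ D.IsCrossing (M.vertex d.1)) ∨
      (D.IsCrossing (M.vertex d.1) ∧ D.IsCrossing (M.vertex e.1) ∧
        Relation.EqvGen D.ArcStep d e))
  have hsymm : ∀ d e, P d e → P e d := by
    rintro d e ⟨h1, ⟨h2, h3⟩ | ⟨h2, h3, h4⟩⟩
    · exact ⟨h1.symm, Or.inl ⟨h2.symm, by rwa [← h2]⟩⟩
    · exact ⟨h1.symm, Or.inr ⟨h3, h2, h4.symm⟩⟩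
  -- Three distinct crossing ends of one arc would be pairwise opposite as over or under, which is
  -- impossible with two values.
  have huniq : ∀ d e e', P d e → P d e' → e = e' := by
    rintro d e e' ⟨h1, h⟩ ⟨h1', h'⟩
    by_contra hne
    by_cases hc : D.IsCrossing (M.vertex d.1)
    · obtain ⟨-, h3, h4⟩ := h.resolve_left fun h => h.2 hc
      obtain ⟨-, h3', h4'⟩ := h'.resolve_left fun h => h.2 hc
      have e1 := halt d e h1.symm hc h3 h4
      have e2 := halt d e' h1'.symm hc h3' h4'
      have e3 := halt e e' hne h3 h3' ((h4.symm).trans _ _ _ h4')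
      tauto
    · obtain ⟨h3, -⟩ := h.resolve_right fun h => hc h.1
      obtain ⟨h3', -⟩ := h'.resolve_right fun h => hc h.1
      obtain ⟨a, -, -, -, ha⟩ := D.exists_partner d.2 hc
      have e1 := (ha e.1 e.2 h3.symm).resolve_left fun h => h1 (Subtype.ext h)
      have e2 := (ha e'.1 e'.2 h3'.symm).resolve_left fun h => h1' (Subtype.ext h)
      exact hne (Subtype.ext (e1.trans e2.symm))
  have hex : ∀ d, ∃ e, P d e := by
    intro d
    by_cases hc : D.IsCrossing (M.vertex d.1)
    · obtain ⟨e, h1, h2, h3⟩ := D.exists_other_end hc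
      exact ⟨e, h1, Or.inr ⟨hc, h2, h3⟩⟩
    · obtain ⟨e, h1, h2, h3, -⟩ := D.exists_partner d.2 hc
      exact ⟨⟨e, h1⟩, fun h => h2 (congrArg Subtype.val h), Or.inl ⟨h3.symm, hc⟩⟩
  choose p hp using hex
  have hpp : ∀ d, p (p d) = d := fun d => huniq (p d) _ _ (hp _) (hsymm _ _ (hp d))
  let f : D.strand → D.strand := fun d => ⟨M.flip d.1, D.strand_flip _ d.2⟩
  have hff : ∀ d, f (f d) = d := fun d => Subtype.ext (M.flip_flip _)
  obtain ⟨o, ho⟩ := Equiv.Perm.exists_coloring_of_involutions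
    ⟨f, f, hff, hff⟩ ⟨p, p, hpp, hpp⟩ hff hpp
    (fun d h => M.flip_ne d.1 (congrArg Subtype.val h)) (fun d => (hp d).1)
  have hof : ∀ d, o (f d) = !o d := fun d => (ho d).1
  have hoP : ∀ d e, P d e → o e = !o d := by
    intro d e h
    rw [huniq d e _ h (hp d)]
    exact (ho d).2
  -- Colours are to be exchanged on the arcs whose ends have the wrong colour.
  let bad : D.strand → Prop := fun d => ∃ e, Relation.EqvGen D.ArcStep d e ∧
    D.IsCrossing (M.vertex e.1) ∧ ¬ (o e = true ↔ D.isOver e.1)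
  have hbad : ∀ d e, Relation.EqvGen D.ArcStep d e → (bad d ↔ bad e) := fun d e h =>
    ⟨fun ⟨a, h1, h2⟩ => ⟨a, h.symm.trans _ _ _ h1, h2⟩, fun ⟨a, h1, h2⟩ => ⟨a, h.trans _ _ _ h1, h2⟩⟩
  let o' : D.strand → Bool := fun d => xor (decide (bad d)) (o d)
  have ho' : ∀ d e, D.ArcStep d e → o e = !o d → o' e = !o' d := by
    intro d e h h'
    simp only [o', h', hbad d e (.rel _ _ h)]
    simp
  refine ⟨fun d => if h : d ∈ D.strand then o' ⟨d, h⟩ else false, ?_, ?_, ?_⟩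
  · intro d hd
    have hd' := D.strand_flip d hd
    simp only [hd, hd', dif_pos]
    exact ho' ⟨d, hd⟩ ⟨_, hd'⟩ (Or.inl rfl) (hof ⟨d, hd⟩)
  · intro d hd e he hne hv hc
    simp only [hd, he, dif_pos]
    exact ho' ⟨d, hd⟩ ⟨e, he⟩ (Or.inr ⟨hv, hc⟩)
      (hoP _ _ ⟨fun h => hne (congrArg Subtype.val h).symm, Or.inl ⟨hv, hc⟩⟩)
  · intro d hc
    have hd := D.mem_strand_of_isCrossing hc
    simp only [hd, dif_pos, o']
    by_cases hb : bad ⟨d, hd⟩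
    · have hb' := hb
      obtain ⟨e, he, hec, heo⟩ := hb
      -- The witness `e` may be the other end of the arc. Both the colour and over/under are
      -- reversed between the two ends, so they are wrong together.
      have hdo : ¬ (o ⟨d, hd⟩ = true ↔ D.isOver d) := by
        by_cases hde : e = ⟨d, hd⟩
        · rwa [hde] at heo
        · have h1 := hoP _ _ (show P ⟨d, hd⟩ e from ⟨hde, Or.inr ⟨hc, hec, he⟩⟩)
          have h2 := halt ⟨d, hd⟩ e (Ne.symm hde) hc hec he
          rw [h1] at heo
          cases h3 : o ⟨d, hd⟩ <;> simp only [h3] at heo ⊢ <;> simp at heo ⊢ <;> tauto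
      simp only [hb', decide_true, Bool.true_xor, Bool.not_eq_true']
      cases h3 : o ⟨d, hd⟩ <;> simp only [h3] at hdo ⊢ <;> simp at hdo ⊢ <;> exact hdo
    · have hdo : (o ⟨d, hd⟩ = true ↔ D.isOver d) := by
        by_contra h
        exact hb ⟨_, .refl _, hc, h⟩
      simpa [hb] using hdo

/-- Between two strand darts at a vertex that is not a crossing there are no other ones. -/
theorem exists_rot_pow_eq {d e : H} (hd : d ∈ D.strand) (he : e ∈ D.strand) (hne : d ≠ e)
    (hv : M.vertex d = M.vertex e) (hc : ¬ D.IsCrossing (M.vertex d)) :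
    ∃ n, (M.rot ^ (n + 1)) d = e ∧ ∀ i, 0 < i → i ≤ n → (M.rot ^ i) d ∉ D.strand := by
  classical
  have hex := M.exists_pow_of_vertex_eq hv
  have h1 := Nat.find_spec hex
  have h2 : ∀ m < Nat.find hex, (M.rot ^ m) d ≠ e := fun m hm => Nat.find_min hex hm
  generalize Nat.find hex = n at h1 h2
  obtain _ | n := n
  · exact absurd h1 hne
  refine ⟨n, h1, fun i hi hin hs => ?_⟩
  obtain ⟨e', -, -, -, h⟩ := D.exists_partner hd hc
  have he' := (h e he hv.symm).resolve_left hne.symm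
  rcases h _ hs (M.vertex_rot_pow i d) with h | h
  · refine h2 (n + 1 - i) (by omega) ?_
    rw [← h1]
    conv_rhs => rw [show n + 1 = (n + 1 - i) + i by omega, pow_add, Equiv.Perm.mul_apply, h]
  · exact h2 i (by omega) (h.trans he'.symm)

/-! ### Shadings of the sectors. -/

/-- A colouring of the sectors in which two adjacent sectors at a vertex have different colours
exactly if the half-edge that separates them lies in the projection. At a crossing, a sector that
follows an over dart has the colour `true` exactly if the crossing is not in `X`. -/
structure IsShading (X : Set M.Vertex) (u : H → Bool) : Prop where
  flip : ∀ {d}, d ∈ D.strand → u (M.flip d) = !u d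
  rot_of_mem : ∀ {d}, M.rot d ∈ D.strand → u (M.rot d) = !u d
  rot_of_notMem : ∀ {d}, M.rot d ∉ D.strand → u (M.rot d) = u d
  crossing : ∀ {d}, D.IsCrossing (M.vertex d) → (u d = true ↔ Xor (M.vertex d ∈ X) (D.isOver d))

theorem IsShading.compl {D : LinkDiagram M} {X : Set M.Vertex} {u : H → Bool} (h : D.IsShading X u) :
    D.IsShading {v | D.IsCrossing v ∧ v ∉ X} (fun d => !u d) where
  flip hd := by rw [h.flip hd]
  rot_of_mem hd := by rw [h.rot_of_mem hd]
  rot_of_notMem hd := by rw [h.rot_of_notMem hd]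
  crossing {d} hd := by
    have := h.crossing hd
    simp only [Bool.not_eq_true', ← Bool.not_eq_true, this, Set.mem_ofPred_eq, hd, true_and, Xor]
    tauto

theorem exists_isShading {X : Set M.Vertex} (halt : (D.switch X).IsAlternating) :
    ∃ u, D.IsShading X u := by
  classical
  obtain ⟨o, ho1, ho2, ho3⟩ := (D.switch X).exists_dart_coloring halt
  change ∀ d ∈ D.strand, o (M.flip d) = !o d at ho1
  change ∀ d ∈ D.strand, ∀ e ∈ D.strand, d ≠ e → M.vertex d = M.vertex e →
        ¬ D.IsCrossing (M.vertex d) → o e = !o d at ho2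
  change ∀ d, D.IsCrossing (M.vertex d) → (o d = true ↔ Xor (M.vertex d ∈ X) (D.isOver d)) at ho3
  -- A sector takes the colour of the last strand dart met when sweeping counterclockwise up to it;
  -- sectors at a vertex off the projection all get `false`.
  let U : H → Prop := fun x => ∃ d ∈ D.strand, ∃ i, (M.rot ^ i) d = x ∧
    (∀ j, 0 < j → j ≤ i → (M.rot ^ j) d ∉ D.strand) ∧ o d = true
  have hmem : ∀ x ∈ D.strand, (U x ↔ o x = true) := by
    intro x hx
    constructor
    · rintro ⟨d, hd, i, hi, hj, h⟩
      obtain _ | i := i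
      · rwa [← hi]
      · exact absurd hx (by rw [← hi]; exact hj _ (Nat.succ_pos _) le_rfl)
    · intro h
      exact ⟨x, hx, 0, rfl, fun j h1 h2 => by omega, h⟩
  refine ⟨fun x => decide (U x), ⟨?_, ?_, ?_, ?_⟩⟩
  · intro d hd
    rw [← decide_not, decide_eq_decide, hmem _ hd, hmem _ (D.strand_flip _ hd), ho1 d hd]
    simp
  · intro x hx
    rw [← decide_not, decide_eq_decide, hmem _ hx]
    by_cases hc : D.IsCrossing (M.vertex x)
    · rw [hmem x (D.mem_strand_of_isCrossing hc), ho3 _ hc, ho3 _ (by rwa [M.vertex_rot]),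
        M.vertex_rot, D.isOver_rot x hc]
      simp only [Xor]
      tauto
    · rw [← M.vertex_rot] at hc
      obtain ⟨e, he, hne, hv, hall⟩ := D.exists_partner hx hc
      obtain ⟨n, hn, hn'⟩ := D.exists_rot_pow_eq he hx hne hv (by rwa [hv])
      have hoe := ho2 _ hx e he hne.symm hv.symm hc
      have hnx : (M.rot ^ n) e = x := by
        rw [pow_succ', Equiv.Perm.mul_apply] at hn
        exact M.rot.injective hn
      have hUx : U x ↔ o e = true := by
        constructor
        · rintro ⟨d, hd, i, hi, hj, h⟩
          have hdx : (M.rot ^ (i + 1)) d = M.rot x := by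
            rw [pow_succ', Equiv.Perm.mul_apply, hi]
          rcases hall d hd (by rw [← hdx, M.vertex_rot_pow]) with rfl | rfl
          -- Here `d` is `M.rot x` itself: sweeping from it towards `x` meets `e` before coming
          -- back, so it is not the last strand dart before `x`.
          · obtain ⟨m, hm, hm'⟩ := D.exists_rot_pow_eq hx he hne.symm hv.symm hc
            by_cases him : m + 1 ≤ i
            · exact absurd he (by rw [← hm]; exact hj _ (Nat.succ_pos _) him)
            · by_cases him' : i = m
              · subst him'
                exact absurd (hm.symm.trans hdx) hne
              · exact absurd hx (by
                  conv => rw [← hdx]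
                  exact hm' _ (Nat.succ_pos _) (by omega))
          · exact h
        · intro h
          exact ⟨e, he, n, hnx, hn', h⟩
      rw [hUx, hoe]
      simp
  · intro x hx
    rw [decide_eq_decide]
    constructor
    · rintro ⟨d, hd, i, hi, hj, h⟩
      obtain _ | i := i
      · exact absurd hd (by rw [show d = M.rot x from hi]; exact hx)
      · rw [pow_succ', Equiv.Perm.mul_apply] at hi
        exact ⟨d, hd, i, M.rot.injective hi, fun j h1 h2 => hj j h1 (by omega), h⟩
    · rintro ⟨d, hd, i, hi, hj, h⟩
      refine ⟨d, hd, i + 1, by rw [pow_succ', Equiv.Perm.mul_apply, hi], fun j h1 h2 => ?_, h⟩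
      rcases Nat.lt_or_ge i j with h3 | h3
      · rwa [show j = i + 1 by omega, pow_succ', Equiv.Perm.mul_apply, hi]
      · exact hj j h1 h3
  · intro d hc
    rw [decide_eq_true_iff, hmem d (D.mem_strand_of_isCrossing hc), ho3 d hc]

end LinkDiagram

namespace LinkDiagram

variable {H : Type*} [Fintype H] [DecidableEq H] {M : SphereMap H} (D : LinkDiagram M)

/-! ### State circles and regions -/

/-- The circles of the `B`-smoothing (for `true`) and of the `A`-smoothing (for `false`). -/
def Circle : Type _ := Σ β : Bool, Quot (D.SmoothStep fun d => (D.isOver d ↔ β = true))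

instance : Finite D.Circle :=
  inferInstanceAs (Finite (Σ β : Bool, Quot (D.SmoothStep fun d => (D.isOver d ↔ β = true))))

theorem card_circle : Nat.card D.Circle = D.circlesA + D.circlesB := by
  rw [Circle, Nat.card_sigma, Fintype.sum_bool, add_comm, circlesA, circlesB]
  simp

/-- The circle of the dart `d` in one of the two smoothings. -/
def circle (β : Bool) {d : H} (hd : d ∈ D.strand) : D.Circle :=
  Sigma.mk β (Quot.mk (D.SmoothStep fun d => (D.isOver d ↔ β = true)) (⟨d, hd⟩ : D.strand))

theorem circle_eq_of_arcStep (β : Bool) {d e : H} (hd : d ∈ D.strand) (he : e ∈ D.strand)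
    (h : D.ArcStep ⟨d, hd⟩ ⟨e, he⟩) : D.circle β hd = D.circle β he :=
  congrArg (Sigma.mk β) (Quot.sound (Or.inl h))

theorem circle_rot {β : Bool} {d : H} (hd : d ∈ D.strand) (hc : D.IsCrossing (M.vertex d))
    (h : D.isOver d ↔ β = true) (hd' : M.rot d ∈ D.strand) : D.circle β hd' = D.circle β hd :=
  (congrArg (Sigma.mk β) (Quot.sound (r := D.SmoothStep fun d => (D.isOver d ↔ β = true))
    (Or.inr ⟨hc, h, rfl⟩))).symm

theorem region_rot_pow {X : Set M.Vertex} {d : H} {n : ℕ}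
    (h : ∀ i, 0 < i → i ≤ n → (M.rot ^ i) d ∉ D.strand) :
    D.region X ((M.rot ^ n) d) = D.region X d := by
  induction n with
  | zero => rfl
  | succ n ih =>
    have h1 := h (n + 1) n.succ_pos le_rfl
    rw [pow_succ', Equiv.Perm.mul_apply] at h1 ⊢
    rw [D.region_rot h1, ih fun i hi hin => h i hi (by omega)]

/-- A sector of colour `β` at the strand dart `d`. -/
def sector (u : H → Bool) (β : Bool) (d : H) : H := if u d = β then d else M.rot⁻¹ d

/-! ### The regions on the two sides of a state circle. -/

namespace IsShading

variable {D} {X : Set M.Vertex} {u : H → Bool} (hu : D.IsShading X u)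
include hu

theorem partner {d e : H} (hd : d ∈ D.strand) (he : e ∈ D.strand) (hne : d ≠ e)
    (hv : M.vertex d = M.vertex e) (hc : ¬ D.IsCrossing (M.vertex d)) :
    u e = (!u d) ∧ D.region X (M.rot⁻¹ e) = D.region X d := by
  obtain ⟨n, hn, hn'⟩ := D.exists_rot_pow_eq hd he hne hv hc
  have h1 : ∀ m ≤ n, u ((M.rot ^ m) d) = u d := by
    intro m hm
    induction m with
    | zero => rfl
    | succ m ih =>
      have h := hn' (m + 1) m.succ_pos hm
      rw [pow_succ', Equiv.Perm.mul_apply] at h ⊢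
      rw [hu.rot_of_notMem h, ih (by omega)]
  rw [pow_succ', Equiv.Perm.mul_apply] at hn
  constructor
  · have he' := he
    rw [← hn] at he' ⊢
    rw [hu.rot_of_mem he', h1 n le_rfl]
  · rw [← hn, M.rot_inv_rot, D.region_rot_pow hn']

/-- The sector of colour `β` beside a `β`-circle stays in one region. Along an edge it stays in one
face, and at a non-crossing only auxiliary half-edges are passed. At a crossing outside `X` the
smoothing arc lies in the sector itself; at one in `X` the two sectors are opposite and a band joins
them. -/
theorem region_sector (β : Bool) {d e : D.strand}
    (h : D.SmoothStep (fun d => (D.isOver d ↔ β = true)) d e) :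
    D.region X (sector (M := M) u β d) = D.region X (sector (M := M) u β e) := by
  obtain ⟨d, hd⟩ := d
  obtain ⟨e, he⟩ := e
  unfold sector
  rcases h with (h | ⟨hv, hc⟩) | ⟨hc, h, h'⟩
  · simp only at h
    subst h
    simp only [hu.flip hd]
    by_cases hβ : u d = β
    · simp only [hβ, if_true, Bool.not_eq_self, if_false, D.region_face]
    · have hβ' : (!u d) = β := by cases hd : u d <;> cases β <;> simp_all
      simp only [hβ, hβ', if_true, if_false]
      rw [← D.region_face X (M.flip d), M.flip_flip]
  · simp only at hv hc
    by_cases hde : d = e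
    · subst hde
      rfl
    obtain ⟨h1, h2⟩ := hu.partner hd he hde hv hc
    obtain ⟨-, h3⟩ := hu.partner he hd (Ne.symm hde) hv.symm (by rwa [← hv])
    simp only [h1]
    by_cases hβ : u d = β
    · simp only [hβ, if_true, Bool.not_eq_self, if_false, h2]
    · have hβ' : (!u d) = β := by cases hd : u d <;> cases β <;> simp_all
      simp only [hβ, hβ', if_true, if_false, h3]
  · simp only at hc h h'
    subst h'
    have h1 := hu.crossing hc
    simp only [hu.rot_of_mem he]
    by_cases hX : M.vertex d ∈ X
    · have hβ : u d = !β := by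
        simp only [hX, Xor, h] at h1
        cases hd : u d <;> cases β <;> simp_all
      have h2 := D.region_rot_sq (X := X) (d := M.rot⁻¹ d) (by rwa [M.vertex_rot_inv])
      simp only [pow_two, Equiv.Perm.mul_apply, M.rot_rot_inv] at h2
      simp only [hβ, Bool.not_not, Bool.not_eq_self, if_true, if_false, h2]
    · have hβ : u d = β := by
        simp only [hX, Xor, h] at h1
        cases hd : u d <;> cases β <;> simp_all
      simp only [hβ, Bool.not_eq_self, if_true, if_false, M.rot_inv_rot]

/-- The regions for complementary sets of dealternators are the vertices of a graph with at most two
components, with the state circles as edges. -/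
theorem card_region_add_card_region_le :
    Nat.card (Quot (D.RegionStep X)) +
      Nat.card (Quot (D.RegionStep {v | D.IsCrossing v ∧ v ∉ X})) ≤ Nat.card D.Circle + 2 := by
  set Y := {v | D.IsCrossing v ∧ v ∉ X}
  have hu' : D.IsShading Y (fun d => !u d) := hu.compl
  have := Fintype.ofFinite (Quot (D.RegionStep X))
  have := Fintype.ofFinite (Quot (D.RegionStep Y))
  have := Fintype.ofFinite D.Circle
  let d₀ : H := M.nonempty.some
  let g : D.Circle → Quot (D.RegionStep X) := fun c =>
    Quot.lift (fun d : D.strand => D.region X (sector (M := M) u c.1 d))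
      (fun _ _ h => hu.region_sector c.1 h) c.2
  let g' : D.Circle → Quot (D.RegionStep Y) := fun c =>
    Quot.lift (fun d : D.strand => D.region Y (sector (M := M) (fun d => !u d) c.1 d))
      (fun _ _ h => hu'.region_sector c.1 h) c.2
  -- The coboundary map of the graph, with evaluation at one region of each kind. Its injectivity
  -- says that every component contains one of these two regions, and comparing dimensions gives the
  -- bound.
  let Φ : ((Quot (D.RegionStep X) ⊕ Quot (D.RegionStep Y)) → ℚ) →ₗ[ℚ] (D.Circle → ℚ) × ℚ × ℚ :=
    (LinearMap.funLeft ℚ ℚ (fun c => Sum.inl (g c)) -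
      LinearMap.funLeft ℚ ℚ (fun c => Sum.inr (g' c))).prod
      ((LinearMap.proj (Sum.inl (D.region X d₀))).prod
        (LinearMap.proj (Sum.inr (D.region Y d₀))))
  have hΦ : Function.Injective Φ := by
    rw [← LinearMap.ker_eq_bot, LinearMap.ker_eq_bot']
    intro f hf
    have h1 : ∀ c, f (Sum.inl (g c)) = f (Sum.inr (g' c)) := fun c =>
      sub_eq_zero.1 (congrFun (congrArg Prod.fst hf) c)
    have h2 : f (Sum.inl (D.region X d₀)) = 0 := congrArg (fun p => p.2.1) hf
    have h3 : f (Sum.inr (D.region Y d₀)) = 0 := congrArg (fun p => p.2.2) hf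
    have h4 : ∀ d ∈ D.strand, f (Sum.inl (D.region X d)) = f (Sum.inr (D.region Y (M.rot⁻¹ d))) ∧
        f (Sum.inl (D.region X (M.rot⁻¹ d))) = f (Sum.inr (D.region Y d)) := by
      intro d hd
      have h5 : f (Sum.inl (D.region X (sector (M := M) u (u d) d))) =
        f (Sum.inr (D.region Y (sector (M := M) (fun d => !u d) (u d) d))) := h1 (D.circle (u d) hd)
      have h6 : f (Sum.inl (D.region X (sector (M := M) u (!u d) d))) =
        f (Sum.inr (D.region Y (sector (M := M) (fun d => !u d) (!u d) d))) :=
          h1 (D.circle (!u d) hd)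
      simp only [sector, if_true, Bool.not_eq_self, Bool.eq_not_self, if_false] at h5 h6
      exact ⟨h5, h6⟩
    -- By `h4`, crossing a strand interchanges the two conditions, while crossing an auxiliary
    -- half-edge preserves each. Their conjunction therefore spreads over the connected cell
    -- decomposition.
    let Z : H → Prop := fun d => f (Sum.inl (D.region X d)) = 0 ∧ f (Sum.inr (D.region Y d)) = 0
    have hrot : ∀ d, Z (M.rot d) ↔ Z d := by
      intro d
      simp only [Z]
      by_cases hd : M.rot d ∈ D.strand
      · obtain ⟨h5, h6⟩ := h4 _ hd
        rw [M.rot_inv_rot] at h5 h6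
        rw [h5, ← h6, and_comm]
      · rw [D.region_rot hd, D.region_rot hd]
    have hflip : ∀ d, Z (M.flip d) ↔ Z d := by
      intro d
      have h5 : Z (M.rot⁻¹ (M.flip d)) ↔ Z d := by
        simp only [Z, D.region_face]
      rw [← h5, ← hrot (M.rot⁻¹ (M.flip d)), M.rot_rot_inv]
    have hZ : ∀ d, Z d := by
      intro d
      obtain ⟨w, hw, rfl⟩ := M.connected d₀ d
      have : ∀ d, Z (w d) ↔ Z d := by
        induction hw using Subgroup.closure_induction with
        | mem x hx =>
          rcases hx with rfl | rfl
          · exact hrot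
          · exact hflip
        | one => exact fun _ => Iff.rfl
        | mul x y _ _ hx hy => exact fun d => (hx _).trans (hy d)
        | inv x _ hx => exact fun d => by rw [← hx (x⁻¹ d), show x (x⁻¹ d) = d from x.apply_symm_apply d]
      exact (this d₀).2 ⟨h2, h3⟩
    ext x
    rcases x with x | x
    · induction x using Quot.inductionOn with | _ d
      exact (hZ d).1
    · induction x using Quot.inductionOn with | _ d
      exact (hZ d).2
  have hdim := LinearMap.finrank_le_finrank_of_injective hΦ
  simp only [Module.finrank_prod, Module.finrank_pi, Module.finrank_self, Fintype.card_sum] at hdim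
  simpa only [Nat.card_eq_fintype_card] using hdim

end IsShading

end LinkDiagram

namespace LinkDiagram

variable {H : Type*} [Fintype H] [DecidableEq H] {M : SphereMap H} (D : LinkDiagram M)

/-! ### Counting darts -/

theorem ncard_eq_sum_vertex (M : SphereMap H) [Fintype M.Vertex] (s : Set H) :
    s.ncard = ∑ v, {d | d ∈ s ∧ M.vertex d = v}.ncard := by
  classical
  rw [Set.ncard_eq_toFinset_card', Finset.card_eq_sum_card_fiberwise (t := Finset.univ)
    (f := M.vertex) (fun _ _ => Finset.mem_coe.2 (Finset.mem_univ _))]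
  refine Finset.sum_congr rfl fun v _ => ?_
  rw [Set.ncard_eq_toFinset_card']
  congr 1
  ext d
  simp

theorem ncard_vertex_mem {X : Set M.Vertex} (hX : ∀ v ∈ X, D.IsCrossing v) :
    {d | M.vertex d ∈ X}.ncard = 4 * X.ncard := by
  classical
  have := Fintype.ofFinite M.Vertex
  rw [ncard_eq_sum_vertex M, Set.ncard_eq_toFinset_card' X, mul_comm, ← smul_eq_mul,
    ← Finset.sum_const, ← Finset.sum_subset (Finset.subset_univ X.toFinset)]
  · refine Finset.sum_congr rfl fun v hv => ?_
    rw [Set.mem_toFinset] at hv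
    rw [← D.ncard_darts_of_isCrossing (hX v hv)]
    congr 1
    ext d
    exact ⟨fun h => h.2, fun h => ⟨by rw [← show M.vertex d = v from h] at hv; exact hv, h⟩⟩
  · intro v _ hv
    rw [Set.mem_toFinset] at hv
    rw [Set.ncard_eq_zero]
    ext d
    simp only [Set.mem_ofPred_eq, Set.mem_empty_iff_false, iff_false, not_and]
    rintro h rfl
    exact hv h

/-- The vertices of the cell decomposition that do not lie on the projection. -/
def IsolatedVertex : Type _ := {v : M.Vertex // ∀ d ∈ D.strand, M.vertex d ≠ v}

instance : Finite D.IsolatedVertex :=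
  inferInstanceAs (Finite {v : M.Vertex // ∀ d ∈ D.strand, M.vertex d ≠ v})

/-- Summed over vertices: valences `0`, `2`, `4` satisfy valence + 2·[isolated] = 2 + 2·[crossing].
-/
theorem ncard_strand :
    D.strand.ncard + 2 * Nat.card D.IsolatedVertex = 2 * Nat.card M.Vertex + 2 * D.crossingNumber := by
  classical
  have := Fintype.ofFinite M.Vertex
  have h1 : Nat.card D.IsolatedVertex =
      ∑ v : M.Vertex, if ∀ d ∈ D.strand, M.vertex d ≠ v then 1 else 0 := by
    rw [IsolatedVertex, Nat.card_eq_fintype_card, Fintype.card_subtype, Finset.card_filter]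
  have h2 : D.crossingNumber = ∑ v : M.Vertex, if D.IsCrossing v then 1 else 0 := by
    rw [crossingNumber, Set.ncard_eq_toFinset_card', ← Finset.card_filter]
    congr 1
    ext v
    simp
  have h3 : Nat.card M.Vertex = ∑ _v : M.Vertex, 1 := by simp
  rw [h1, h2, h3, ncard_eq_sum_vertex M, Finset.mul_sum, Finset.mul_sum, Finset.mul_sum,
    ← Finset.sum_add_distrib, ← Finset.sum_add_distrib]
  refine Finset.sum_congr rfl fun v _ => ?_
  have h0 : (∀ d ∈ D.strand, M.vertex d ≠ v) ↔
      {d | d ∈ D.strand ∧ M.vertex d = v}.ncard = 0 := by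
    rw [Set.ncard_eq_zero, Set.eq_empty_iff_forall_notMem]
    exact forall_congr' fun d => not_and.symm
  have hval := D.valence v
  simp only [h0, IsCrossing]
  rcases hval with h | h | h <;> simp only [show _ = _ from h] <;> norm_num

/-! ### The ribbon graph of the faces -/

/-- The boundaries of the faces, each subdivided into sectors (`false`) and edge sides (`true`). -/
def boundaryWalk (M : SphereMap H) : Equiv.Perm (H × Bool) where
  toFun x := if x.2 then (M.rot⁻¹ (M.flip x.1), false) else (x.1, true)
  invFun x := if x.2 then (x.1, false) else (M.flip (M.rot x.1), true)
  left_inv := by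
    rintro ⟨d, _ | _⟩
    · simp
    · simp only [if_true, M.rot_rot_inv, M.flip_flip, Bool.false_eq_true, if_false]
  right_inv := by
    rintro ⟨d, _ | _⟩
    · simp only [if_true, M.flip_flip, M.rot_inv_rot, Bool.false_eq_true, if_false]
    · simp

open Classical in
/-- How the faces are joined: across the edges outside the projection, and by bands at `X`. -/
noncomputable def joinFun (X : Set M.Vertex) (x : H × Bool) : H × Bool :=
  if x.2 then (if x.1 ∈ D.strand then x.1 else M.flip x.1, true)
  else (if M.vertex x.1 ∈ X then (M.rot ^ 2) x.1 else x.1, false)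

theorem joinFun_joinFun {X : Set M.Vertex} (hX : ∀ v ∈ X, D.IsCrossing v) (x : H × Bool) :
    D.joinFun X (D.joinFun X x) = x := by
  obtain ⟨d, _ | _⟩ := x
  · by_cases hd : M.vertex d ∈ X
    · simp only [joinFun, Bool.false_eq_true, if_false, hd, if_true, M.vertex_rot_pow,
        D.rot_sq_rot_sq (hX _ hd)]
    · simp [joinFun, hd]
  · by_cases hd : d ∈ D.strand
    · simp [joinFun, hd]
    · simp [joinFun, hd, D.flip_mem_strand_iff, M.flip_flip]

/-- `joinFun` as a permutation. -/
noncomputable def join {X : Set M.Vertex} (hX : ∀ v ∈ X, D.IsCrossing v) :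
    Equiv.Perm (H × Bool) :=
  ⟨D.joinFun X, D.joinFun X, D.joinFun_joinFun hX, D.joinFun_joinFun hX⟩

section Ribbon

variable {X : Set M.Vertex} (hX : ∀ v ∈ X, D.IsCrossing v)

theorem boundaryWalk_false (d : H) : boundaryWalk M (d, false) = (d, true) := rfl

theorem boundaryWalk_true (d : H) :
    boundaryWalk M (d, true) = (M.rot⁻¹ (M.flip d), false) := rfl

theorem join_true_of_mem {d : H} (hd : d ∈ D.strand) : D.join hX (d, true) = (d, true) := by
  simp [join, joinFun, hd]

theorem join_true_of_notMem {d : H} (hd : d ∉ D.strand) :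
    D.join hX (d, true) = (M.flip d, true) := by
  simp [join, joinFun, hd]

theorem join_false_of_mem {d : H} (hd : M.vertex d ∈ X) :
    D.join hX (d, false) = ((M.rot ^ 2) d, false) := by
  simp [join, joinFun, hd]

theorem join_false_of_notMem {d : H} (hd : M.vertex d ∉ X) :
    D.join hX (d, false) = (d, false) := by
  simp [join, joinFun, hd]

theorem card_orbit_le :
    Nat.card (Quot (Equiv.Perm.OrbitStep (boundaryWalk M) (D.join hX))) ≤
      Nat.card (Quot (D.RegionStep X)) := by
  let q : H × Bool → Quot (Equiv.Perm.OrbitStep (boundaryWalk M) (D.join hX)) := Quot.mk _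
  have hw : ∀ x, q (boundaryWalk M x) = q x := fun x => 
    (Quot.sound (r := Equiv.Perm.OrbitStep _ _) (Or.inl rfl)).symm
  have hj : ∀ x, q (D.join hX x) = q x := fun x => 
    (Quot.sound (r := Equiv.Perm.OrbitStep _ _) (Or.inr rfl)).symm
  let g : Quot (D.RegionStep X) → Quot (Equiv.Perm.OrbitStep (boundaryWalk M) (D.join hX)) :=
    Quot.lift (fun d => q (d, false)) (by
      rintro d _ (rfl | ⟨rfl, h⟩ | ⟨h, rfl⟩)
      · rw [← boundaryWalk_true, hw, ← boundaryWalk_false, hw]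
      · rw [← hw (M.rot d, false), boundaryWalk_false, ← hj (M.rot d, true), D.join_true_of_notMem hX h,
          ← hw (M.flip (M.rot d), true),
          boundaryWalk_true, M.flip_flip, M.rot_inv_rot]
      · rw [← D.join_false_of_mem hX h, hj])
  refine Nat.card_le_card_of_surjective g fun c => ?_
  induction c using Quot.inductionOn with | _ x
  obtain ⟨d, _ | _⟩ := x
  · exact ⟨D.region X d, rfl⟩
  · exact ⟨D.region X d, (hw (d, false)).symm⟩

/-- The sides of strand edges and the sectors away from `X` are left unjoined. -/
theorem card_add_card_fixed_join :
    D.strand.ncard + Fintype.card H ≤ Nat.card {x // D.join hX x = x} + 4 * X.ncard := by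
  have h1 := Set.ncard_add_ncard_compl {d | M.vertex d ∈ X}
  rw [D.ncard_vertex_mem hX, Nat.card_eq_fintype_card] at h1
  have h2 : Nat.card (D.strand ⊕ ({d | M.vertex d ∈ X}ᶜ : Set H)) ≤
      Nat.card {x // D.join hX x = x} := by
    refine Nat.card_le_card_of_injective
      (Sum.elim (fun d => ⟨(d.1, true), D.join_true_of_mem hX d.2⟩)
        (fun d => ⟨(d.1, false), D.join_false_of_notMem hX d.2⟩)) ?_
    rintro (a | a) (b | b) h <;>
      simp only [Sum.elim_inl, Sum.elim_inr, Subtype.mk.injEq, Prod.mk.injEq, and_true,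
        Bool.false_eq_true, Bool.true_eq_false, and_false] at h
    · rw [Subtype.ext h]
    · rw [Subtype.ext h]
  rw [Nat.card_sum, Nat.card_coe_set_eq, Nat.card_coe_set_eq] at h2
  omega

end Ribbon

/-! ### The boundary components of the ribbon graph -/

section Boundary

open Classical in
/-- The dart of the projection reached first from the sector `d` along the boundary of its region (any
dart at a vertex that is not a crossing). -/
noncomputable def nextDart (X : Set M.Vertex) (d : H) : H :=
  if D.IsCrossing (M.vertex d) then if M.vertex d ∈ X then (M.rot ^ 2) d else d
  else if h : ∃ e ∈ D.strand, M.vertex e = M.vertex d then h.choose else d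

theorem vertex_nextDart (X : Set M.Vertex) (d : H) : M.vertex (D.nextDart X d) = M.vertex d := by
  unfold nextDart
  split_ifs with h1 h2 h3
  · rw [M.vertex_rot_pow]
  · rfl
  · exact h3.choose_spec.2
  · rfl

theorem nextDart_mem {X : Set M.Vertex} {d : H} (h : ∃ e ∈ D.strand, M.vertex e = M.vertex d) :
    D.nextDart X d ∈ D.strand := by
  by_cases hc : D.IsCrossing (M.vertex d)
  · exact D.mem_strand_of_isCrossing (by rwa [vertex_nextDart])
  · rw [nextDart, if_neg hc, dif_pos h]
    exact h.choose_spec.1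

open Classical in
/-- The boundary component at the sector `d`. -/
noncomputable def sectorComponent (X : Set M.Vertex) (u : H → Bool) (d : H) :
    D.Circle ⊕ D.IsolatedVertex :=
  if h : ∃ e ∈ D.strand, M.vertex e = M.vertex d then
    Sum.inl (D.circle (u d) (D.nextDart_mem (X := X) h))
  else Sum.inr ⟨M.vertex d, fun e he hv => h ⟨e, he, hv⟩⟩

/-- Strand darts at a non-crossing lie on the same arc, so the choice made in `nextDart` does not
matter. -/
theorem sectorComponent_of_not_isCrossing {X : Set M.Vertex} {u : H → Bool} {d e : H}
    (hc : ¬ D.IsCrossing (M.vertex d)) (he : e ∈ D.strand) (hv : M.vertex e = M.vertex d) :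
    D.sectorComponent X u d = Sum.inl (D.circle (u d) he) := by
  rw [sectorComponent, dif_pos ⟨e, he, hv⟩]
  refine congrArg _ (D.circle_eq_of_arcStep _ _ _ (Or.inr ⟨?_, ?_⟩))
  · rw [vertex_nextDart, hv]
  · simpa only [vertex_nextDart] using hc

theorem sectorComponent_of_isCrossing {X : Set M.Vertex} {u : H → Bool} {d e : H}
    (hc : D.IsCrossing (M.vertex d)) (he : e ∈ D.strand)
    (h : e = D.nextDart X d) :
    D.sectorComponent X u d = Sum.inl (D.circle (u d) he) := by
  subst h
  rw [sectorComponent, dif_pos ⟨d, D.mem_strand_of_isCrossing hc, rfl⟩]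

open Classical in
/-- The boundary component at a sector or at the left side of an edge. -/
noncomputable def component (X : Set M.Vertex) (u : H → Bool) (x : H × Bool) :
    D.Circle ⊕ D.IsolatedVertex :=
  if h : x.2 = true ∧ x.1 ∈ D.strand then Sum.inl (D.circle (u x.1) h.2)
  else D.sectorComponent X u x.1

theorem component_false {X : Set M.Vertex} {u : H → Bool} (d : H) :
    D.component X u (d, false) = D.sectorComponent X u d := by
  simp [component]

theorem component_true_of_notMem {X : Set M.Vertex} {u : H → Bool} {d : H} (hd : d ∉ D.strand) :
    D.component X u (d, true) = D.sectorComponent X u d := by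
  simp [component, hd]

theorem component_true_of_mem {X : Set M.Vertex} {u : H → Bool} {d : H} (hd : d ∈ D.strand) :
    D.component X u (d, true) = Sum.inl (D.circle (u d) hd) := by
  simp [component, hd]

namespace IsShading

variable {D} {X : Set M.Vertex} {u : H → Bool} (hu : D.IsShading X u)
  (hX : ∀ v ∈ X, D.IsCrossing v)
include hu

/-- A strand edge is followed by the sector at its other end. -/
theorem sectorComponent_flip {d : H} (hd : d ∈ D.strand) :
    D.sectorComponent X u (M.rot⁻¹ (M.flip d)) = Sum.inl (D.circle (u d) hd) := by
  have hfd := D.strand_flip d hd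
  have hcirc : D.circle (u d) hfd = D.circle (u d) hd :=
    (D.circle_eq_of_arcStep _ hd hfd (Or.inl rfl)).symm
  set e := M.rot⁻¹ (M.flip d) with he
  have hre : M.rot e = M.flip d := M.rot_rot_inv _
  have hue : u e = u d := by
    have h1 := hu.rot_of_mem (d := e) (by rwa [hre])
    rw [hre, hu.flip hd] at h1
    simpa using h1.symm
  have hv : M.vertex (M.flip d) = M.vertex e := by rw [← hre, M.vertex_rot]
  by_cases hc : D.IsCrossing (M.vertex e)
  · have hes := D.mem_strand_of_isCrossing hc
    have hre' : M.rot e ∈ D.strand := by rwa [hre]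
    have hcirc' : D.circle (u d) hre' = D.circle (u d) hd := by
      rw [← hcirc]
      congr 1
    -- At a dealternator the colour disagrees with over/under, so the circle turns from `M.rot e` on
    -- to the next dart, along the edge of a band. At other crossings it turns between `e` and
    -- `M.rot e`, inside the sector.
    by_cases hvX : M.vertex e ∈ X
    · have hr : M.rot (M.rot e) ∈ D.strand :=
        D.mem_strand_of_isCrossing (by rwa [M.vertex_rot, M.vertex_rot])
      rw [D.sectorComponent_of_isCrossing hc hr, hue, D.circle_rot hre', hcirc']
      · rwa [M.vertex_rot]
      · have h1 := hu.crossing (d := e) hc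
        rw [D.isOver_rot e hc, ← hue, h1]
        simp [hvX, Xor]
      · rw [nextDart, if_pos hc, if_pos hvX, pow_two, Equiv.Perm.mul_apply]
    · have h1 := hu.crossing (d := e) hc
      rw [D.sectorComponent_of_isCrossing hc hes, hue, ← D.circle_rot hes hc _ hre', hcirc']
      · rw [← hue, h1]
        simp [hvX, Xor]
      · rw [nextDart, if_pos hc, if_neg hvX]
  · rw [D.sectorComponent_of_not_isCrossing hc hfd hv, hue, hcirc]

/-- Joining and then walking on traces the boundary of the assembled regions: it follows a state
circle, or goes round a vertex off the projection. -/
theorem component_boundaryWalk_join (x : H × Bool) :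
    D.component X u (boundaryWalk M (D.join hX x)) = D.component X u x := by
  obtain ⟨d, _ | _⟩ := x
  · by_cases hd : M.vertex d ∈ X
    · have hc := hX _ hd
      have h2 : (M.rot ^ 2) d ∈ D.strand :=
        D.mem_strand_of_isCrossing (by rwa [M.vertex_rot_pow])
      have h1 : M.rot d ∈ D.strand := D.mem_strand_of_isCrossing (by rwa [M.vertex_rot])
      have hu2 : u ((M.rot ^ 2) d) = u d := by
        have h2' := h2
        rw [pow_two, Equiv.Perm.mul_apply] at h2' ⊢
        rw [hu.rot_of_mem h2', hu.rot_of_mem h1, Bool.not_not]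
      rw [D.join_false_of_mem hX hd, boundaryWalk_false, D.component_true_of_mem h2,
        D.component_false, D.sectorComponent_of_isCrossing hc h2, hu2]
      rw [nextDart, if_pos hc, if_pos hd]
    · rw [D.join_false_of_notMem hX hd, boundaryWalk_false, D.component_false]
      by_cases hs : d ∈ D.strand
      · rw [D.component_true_of_mem hs]
        by_cases hc : D.IsCrossing (M.vertex d)
        · rw [D.sectorComponent_of_isCrossing hc hs]
          rw [nextDart, if_pos hc, if_neg hd]
        · rw [D.sectorComponent_of_not_isCrossing hc hs rfl]
      · rw [D.component_true_of_notMem hs]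
  · by_cases hs : d ∈ D.strand
    · rw [D.join_true_of_mem hX hs, boundaryWalk_true, D.component_false,
        D.component_true_of_mem hs, hu.sectorComponent_flip hs]
    · rw [D.join_true_of_notMem hX hs, boundaryWalk_true, M.flip_flip, D.component_false,
        D.component_true_of_notMem hs]
      have hv : M.vertex (M.rot⁻¹ d) = M.vertex d := M.vertex_rot_inv d
      have hud : u d = u (M.rot⁻¹ d) := by
        have := hu.rot_of_notMem (d := M.rot⁻¹ d) (by rwa [M.rot_rot_inv])
        rwa [M.rot_rot_inv] at this
      have hc : ¬ D.IsCrossing (M.vertex d) := fun h => hs (D.mem_strand_of_isCrossing h)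
      by_cases h : ∃ e ∈ D.strand, M.vertex e = M.vertex d
      · obtain ⟨e, he, hve⟩ := h
        rw [D.sectorComponent_of_not_isCrossing hc he hve,
          D.sectorComponent_of_not_isCrossing (by rwa [hv]) he (hve.trans hv.symm), hud]
      · rw [sectorComponent, sectorComponent, dif_neg h, dif_neg (by rwa [hv])]
        exact congrArg Sum.inr (Subtype.ext hv)

theorem component_surjective : Function.Surjective (D.component X u) := by
  rintro (⟨β, c⟩ | ⟨v, hv⟩)
  · induction c using Quot.inductionOn with | _ d
    obtain ⟨d, hd⟩ := d
    by_cases hβ : u d = β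
    · subst hβ
      exact ⟨(d, true), D.component_true_of_mem hd⟩
    · have hβ' : u (M.flip d) = β := by
        rw [hu.flip hd]
        cases h : u d <;> cases β <;> simp_all
      subst hβ'
      refine ⟨(M.flip d, true), (D.component_true_of_mem (D.strand_flip d hd)).trans ?_⟩
      exact congrArg Sum.inl (D.circle_eq_of_arcStep _ hd _ (Or.inl rfl)).symm
  · obtain ⟨d, rfl⟩ := M.exists_vertex_eq v
    refine ⟨(d, false), ?_⟩
    rw [D.component_false, sectorComponent, dif_neg]
    rintro ⟨e, he, h⟩
    exact hv e he h

include hX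

/-- The regions, capped off along the state circles, have Euler characteristic at most `2` each. -/
theorem le_two_mul_card_region :
    D.crossingNumber + 2 + Nat.card D.Circle ≤
      2 * Nat.card (Quot (D.RegionStep X)) + 2 * X.ncard := by
  have h1 := Equiv.Perm.card_cycles_le (boundaryWalk M) (D.join hX)
    (a := fun x => Quotient.mk (Equiv.Perm.SameCycle.setoid (M.rot⁻¹ * M.flip)) x.1)
    (fun c => by
      induction c using Quotient.inductionOn with | _ d
      exact ⟨(d, false), rfl⟩)
    (by
      rintro ⟨d, _ | _⟩
      · rfl
      · exact Quotient.sound (Equiv.Perm.sameCycle_apply_left.2 (.refl _ _)))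
    (b := fun x => Quotient.mk (Equiv.Perm.SameCycle.setoid (D.join hX)) x)
    Quotient.mk_surjective
    (fun x => Quotient.sound (Equiv.Perm.sameCycle_apply_left.2 (.refl _ _)))
    (c := D.component X u) hu.component_surjective (hu.component_boundaryWalk_join hX)
  have h2 := Equiv.Perm.card_add_card_fixed_le (D.join hX) (D.joinFun_joinFun hX)
  have h3 := Equiv.Perm.card_add_card_fixed_le M.flip M.flip_flip
  have h4 := D.card_add_card_fixed_join hX
  have h5 := D.ncard_strand
  have h6 := D.card_orbit_le hX
  have h7 : (Nat.card M.Vertex : ℤ) - _ + _ = 2 := M.euler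
  rw [Nat.card_sum] at h1
  rw [Fintype.card_prod, Fintype.card_bool] at h1 h2
  -- With `V`, `E`, `F` the numbers of cells, `s` the number of circles and `R` that of regions,
  -- doubling `h1` and inserting `h2`, `h4`, `h5` gives `2F + 2V + 2n + 2s ≤ |H| + 4R + 4|X|`. Then
  -- use `|H| ≤ 2E` and Euler's formula.
  omega

end IsShading

end Boundary

end LinkDiagram

/-! ### The squeeze. -/

theorem mainTheorem5 {H : Type*} [Fintype H] [DecidableEq H] (M : SphereMap H)
    (D : LinkDiagram M) (k : ℕ) (hD : D.IsAlmostAlternating k)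
    (X : Set M.Vertex) (hX : D.AlternatingAfter X k) :
    (D.circlesA : ℤ) + D.circlesB = 2 * k + 2 * D.regions X - D.crossingNumber - 2 := by
  obtain ⟨hXc, hXk, halt⟩ := hX
  obtain ⟨u, hu⟩ := D.exists_isShading halt
  have h1 := hu.le_two_mul_card_region hXc
  have h2 := hu.compl.le_two_mul_card_region fun v hv => hv.1
  have h3 := hu.card_region_add_card_region_le
  have h4 : {v | D.IsCrossing v ∧ v ∉ X}.ncard + X.ncard = D.crossingNumber :=
    Set.ncard_sdiff_add_ncard_of_subset (s := X) (t := {v | D.IsCrossing v}) hXc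
  rw [D.card_circle] at h1 h2 h3
  rw [D.regions_eq hXc]
  -- The sum of `h1` and `h2` is the reverse of twice `h3`, which forces equality in `h1`.
  omega
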